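/- A matching of size $n$ is a fixed-point free involution $\mathfrak m$ of $[2n]=\{1,\dots,2n\}$; its chords are the $n$ pairs $\{i,\mathfrak m(i)\}$. A circular interval of $[2n]$ is a (possibly empty) set of consecutive elements modulo $2n$. For $k\ge 0$, $\mathfrak m$ is $k$-decomposable if $[2n]$ can be partitioned into four (possibly empty) circular intervals $C_1,C_2,C_3,C_4$ such that $1\in C_1$, the nonempty sets among $C_2,C_3,C_4$ are ordered by their smallest elements, each chord has either both extremities in $C_1\cup C_3$ or both in $C_2\cup C_4$, and exactly $k$ chords have their extremities in $C_2\cup C_4$. The matching is decomposable if it is $k$-decomposable for some integer $k$ with $2\le k\le n-2$, and indecomposable otherwise. Let $M_n$ be a uniform random matching of size $n$. Then: 1. for all sufficiently large $n$, $\mathbb P(M_n \text{ is indecomposable})>e^{-4}$; 2. $\mathbb P(M_n\text{ is not }2\text{-decomposable})\to e^{-3}$ as $n\to\infty$; 3. for a matching $\mathfrak m$ of size $n$, and with points and congruences taken modulo $2n$, let $x(\mathfrak m)=\#\{i:\mathfrak m(i)\equiv i+1\}$, $y(\mathfrak m)=\#\{j:\mathfrak m(j)\equiv j+2\}$ and $z(\mathfrak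 m)=\#\{(k,\ell): 1\le k<\ell\le 2n,\ \ell-k\not\equiv\pm1,\ \{\mathfrak m(k),\mathfrak m(k+1)\}\equiv\{\ell,\ell+1\}\}$. Then $(x(M_n),y(M_n),z(M_n))$ converges in distribution, as $n\to\infty$, to a triple of independent Poisson random variables with mean $1$; 4. $\mathbb P(M_n\text{ is }k\text{-decomposable for some }k\text{ with }3\le k\le n-2)=O(1/n)$ as $n\to\infty$. -/

import Mathlib

open MeasureTheory ProbabilityTheory Filter Topology Asymptotics

/-- A matching of size `n`: a fixed-point free involution of the `2n` points of a circle.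
The points `1, …, 2n` are represented by `0, …, 2n - 1`. -/
def Matching (n : ℕ) : Type :=
  {f : Fin (2 * n) → Fin (2 * n) // Function.Involutive f ∧ ∀ i, f i ≠ i}

namespace Matching

instance (n : ℕ) : CoeFun (Matching n) (fun _ => Fin (2 * n) → Fin (2 * n)) := ⟨Subtype.val⟩

noncomputable instance (n : ℕ) : Fintype (Matching n) := by
  classical
  unfold Matching
  infer_instance

instance (n : ℕ) : MeasurableSpace (Matching n) := ⊤

instance (n : ℕ) : DiscreteMeasurableSpace (Matching n) := ⟨fun _ => trivial⟩

/-- The reversal `i ↦ 2n - 1 - i` is a matching, so there is at least one for every `n`. -/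
instance (n : ℕ) : Nonempty (Matching n) := by
  refine ⟨⟨Fin.rev, Fin.rev_rev, fun i h => ?_⟩⟩
  have h1 := congrArg Fin.val h
  rw [Fin.val_rev] at h1
  have h2 := i.isLt
  omega

/-- The set of chords `{i, m(i)}` of a matching. -/
def chords {n : ℕ} (m : Matching n) : Finset (Finset (Fin (2 * n))) :=
  Finset.univ.image fun i => {i, m i}

end Matching

/-- A circular interval of `N` points on a circle: `l` consecutive points starting at `a`,
modulo `N`. The empty set (`l = 0`) and the whole circle (`l = N`) are circular intervals. -/
def IsCircularInterval {N : ℕ} (S : Finset (Fin N)) : Prop :=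
  ∃ a l : ℕ, ∀ i : Fin N, i ∈ S ↔ ∃ t < l, (i : ℕ) = (a + t) % N

/-- `(C 0, C 1, C 2, C 3)` (usually written `C₁, C₂, C₃, C₄`) is a `k`-decomposition of `m`. -/
structure IsDecomposition {n : ℕ} (m : Matching n) (k : ℕ)
    (C : Fin 4 → Finset (Fin (2 * n))) : Prop where
  partition : ∀ i, ∃! j, i ∈ C j
  circular : ∀ j, IsCircularInterval (C j)
  first : ∃ i ∈ C 0, (i : ℕ) = 0
  ordered : ∀ j j' : Fin 4, 0 < j → j < j' → ∀ (h : (C j).Nonempty) (h' : (C j').Nonempty),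
    (C j).min' h < (C j').min' h'
  chords_subset : ∀ c ∈ m.chords, c ⊆ C 0 ∪ C 2 ∨ c ⊆ C 1 ∪ C 3
  card_chords : (m.chords.filter fun c => c ⊆ C 1 ∪ C 3).card = k

namespace Matching

/-- `m` is `k`-decomposable. -/
def IsKDecomposable {n : ℕ} (m : Matching n) (k : ℕ) : Prop :=
  ∃ C : Fin 4 → Finset (Fin (2 * n)), IsDecomposition m k C

/-- `m` is decomposable: it is `k`-decomposable for some `k` with `2 ≤ k ≤ n - 2`
(the difference being taken in the integers). -/
def IsDecomposable {n : ℕ} (m : Matching n) : Prop :=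
  ∃ k : ℕ, 2 ≤ k ∧ k + 2 ≤ n ∧ m.IsKDecomposable k

def IsIndecomposable {n : ℕ} (m : Matching n) : Prop :=
  ¬ m.IsDecomposable

/-- The point `i + 1` modulo `2n`. -/
def next {n : ℕ} (i : Fin (2 * n)) : Fin (2 * n) :=
  ⟨((i : ℕ) + 1) % (2 * n), Nat.mod_lt _ (Nat.zero_lt_of_lt i.isLt)⟩

/-- The number of points `i` with `m(i) ≡ i + 1` modulo `2n`. -/
def countX {n : ℕ} (m : Matching n) : ℕ :=
  (Finset.univ.filter fun i : Fin (2 * n) => m i = next i).card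

/-- The number of points `j` with `m(j) ≡ j + 2` modulo `2n`. -/
def countY {n : ℕ} (m : Matching n) : ℕ :=
  (Finset.univ.filter fun j : Fin (2 * n) => m j = next (next j)).card

/-- The number of pairs `k < l`, with `l - k` not congruent to `1` or `-1` modulo `2n`, such that
`{m(k), m(k + 1)} = {l, l + 1}` modulo `2n`. -/
def countZ {n : ℕ} (m : Matching n) : ℕ :=
  (Finset.univ.filter fun p : Fin (2 * n) × Fin (2 * n) =>
    p.1 < p.2 ∧ p.2 ≠ next p.1 ∧ p.1 ≠ next p.2 ∧
      ({m p.1, m (next p.1)} : Finset (Fin (2 * n))) = {p.2, next p.2}).card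

end Matching

/-- The law of a uniform random matching of size `n`. -/
noncomputable def uniformMatching (n : ℕ) : Measure (Matching n) :=
  uniformOn Set.univ

instance (n : ℕ) : IsProbabilityMeasure (uniformMatching n) :=
  isProbabilityMeasure_uniformOn Set.finite_univ Set.univ_nonempty

/-! Everything rests on a switching argument. Exchanging the labels `b` and `m a` turns a uniform
matching `m` into a uniform matching containing the chord {a, b} (`mean_join`). One or two such
switchings give `Pattern.force`, whose law is that of `m` conditioned on a given pattern. The
patterns are the configurations counted by x, y and z: a chord of length one, a chord of length two,
or two chords joining a pair of neighbours to another such pair. The first two kinds have 2n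
patterns of probability 1/(2n-1), the third 2n(2n-3) patterns of probability 1/((2n-1)(2n-3)), so
each count has mean 2n/(2n-1).

Let N be the vector of the three counts and e_t a unit vector. Conditioning on each pattern α of
kind t gives (v_t+1) P(N = v+e_t) = Σ_α P(α) P(N(force α m) = v+e_t). Unless the points involved in
the switching lie on other patterns, forcing α only adds α to the list (`patterns_force`); first and
second moments show that the exceptions cost O(1/n) in total (`sum_prob_interferes_le`). Hence
(v_t+1) P(N = v+e_t) = P(N = v) + O(1/n) (`abs_recursion_le`), which is in the limit the recursion
of independent Poisson variables of mean 1; tightness fixes the constant e^{-3}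
(`tendsto_of_recursion`).

A 2-decomposition isolates four points lying on two arcs, which forces a pattern. Conversely a
pattern extends to four such points, and these give a 2-decomposition as soon as they avoid the
first point of the circle, which fails with probability O(1/n). So "not 2-decomposable" agrees with
N = 0 up to O(1/n).

For k ≥ 3 a union bound suffices. A given set of 2j points is closed under the matching with
probability at most (2j-1)!!/((2n-1)(2n-3)⋯(2n-2j+1)), and O(j n²) pairs of arcs have 2j points.
With j = min(k, n-k), the values j ≥ 3 contribute O(1/n). If k = n-2, then j = 2, but one of the two
arcs contains the first point, which leaves O(n) pairs and again O(1/n). Indecomposability thus has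
lower limit at least e^{-3} > e^{-4}. -/

/-! ### Indicators -/

/-- The indicator of a proposition, as a real number. -/
noncomputable def ind (p : Prop) : ℝ := open Classical in if p then 1 else 0

theorem ind_of {p : Prop} (h : p) : ind p = 1 := by simp [ind, h]

theorem ind_of_not {p : Prop} (h : ¬ p) : ind p = 0 := by simp [ind, h]

theorem ind_nonneg (p : Prop) : 0 ≤ ind p := by
  by_cases h : p <;> simp [ind, h]

theorem ind_le_one (p : Prop) : ind p ≤ 1 := by
  by_cases h : p <;> simp [ind, h]

theorem ind_mono {p q : Prop} (h : p → q) : ind p ≤ ind q := by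
  by_cases hp : p
  · rw [ind_of hp, ind_of (h hp)]
  · rw [ind_of_not hp]; exact ind_nonneg q

theorem ind_congr {p q : Prop} (h : p ↔ q) : ind p = ind q := by rw [propext h]

theorem ind_and (p q : Prop) : ind (p ∧ q) = ind p * ind q := by
  by_cases hp : p <;> by_cases hq : q <;> simp [ind, hp, hq]

theorem ind_or_le (p q : Prop) : ind (p ∨ q) ≤ ind p + ind q := by
  by_cases hp : p <;> by_cases hq : q <;> simp [ind, hp, hq]

theorem ind_exists_le {ι : Type*} (s : Finset ι) (p : ι → Prop) :
    ind (∃ i ∈ s, p i) ≤ ∑ i ∈ s, ind (p i) := by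
  by_cases h : ∃ i ∈ s, p i
  · obtain ⟨i, hi, hp⟩ := h
    rw [ind_of ⟨i, hi, hp⟩, ← ind_of hp]
    exact Finset.single_le_sum (f := fun i => ind (p i)) (fun i _ => ind_nonneg _) hi
  · rw [ind_of_not h]
    exact Finset.sum_nonneg fun i _ => ind_nonneg _

theorem card_filter_eq_sum_ind {ι : Type*} (s : Finset ι) (p : ι → Prop) [DecidablePred p] :
    ((s.filter p).card : ℝ) = ∑ i ∈ s, ind (p i) := by
  rw [Finset.card_filter]
  push_cast
  refine Finset.sum_congr rfl fun i _ => ?_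
  by_cases h : p i <;> simp [ind, h]

theorem sum_ind_mul {ι : Type*} [Fintype ι] [DecidableEq ι] (a : ι) (f : ι → ℝ) :
    ∑ u, ind (a = u) * f u = f a := by
  rw [Finset.sum_eq_single a]
  · simp [ind]
  · intro b _ hb
    rw [ind_of_not (fun h => hb h.symm), zero_mul]
  · simp

/-! ### Averages over matchings, relabelling and switching -/

namespace Matching

variable {n : ℕ}

theorem apply_apply (m : Matching n) (i : Fin (2 * n)) : m (m i) = i := m.2.1 i

theorem apply_ne (m : Matching n) (i : Fin (2 * n)) : m i ≠ i := m.2.2 i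

theorem apply_eq_comm (m : Matching n) {i j : Fin (2 * n)} : m i = j ↔ m j = i := by
  constructor <;> rintro rfl <;> exact m.apply_apply _

theorem injective (m : Matching n) : Function.Injective m := m.2.1.injective

theorem ext' {m m' : Matching n} (h : ∀ i, m i = m' i) : m = m' := Subtype.ext (funext h)

/-- The average of a function over all matchings of size `n`. -/
noncomputable def mean (f : Matching n → ℝ) : ℝ := Finset.univ.expect f

theorem mean_add (f g : Matching n → ℝ) : mean (fun m => f m + g m) = mean f + mean g :=
  Finset.expect_add_distrib _ _ _

theorem mean_sub (f g : Matching n → ℝ) : mean (fun m => f m - g m) = mean f - mean g :=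
  Finset.expect_sub_distrib _ _ _

theorem mean_sum {ι : Type*} (s : Finset ι) (f : ι → Matching n → ℝ) :
    mean (fun m => ∑ i ∈ s, f i m) = ∑ i ∈ s, mean (f i) := by
  unfold mean
  rw [Finset.expect_sum_comm]

theorem mean_const (a : ℝ) : mean (fun _ : Matching n => a) = a :=
  Finset.expect_const Finset.univ_nonempty a

theorem mean_mul_left (a : ℝ) (f : Matching n → ℝ) : mean (fun m => a * f m) = a * mean f :=
  (Finset.mul_expect _ _ _).symm

theorem mean_mul_right (f : Matching n → ℝ) (a : ℝ) : mean (fun m => f m * a) = mean f * a :=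
  (Finset.expect_mul _ _ _).symm

theorem mean_mono {f g : Matching n → ℝ} (h : ∀ m, f m ≤ g m) : mean f ≤ mean g :=
  Finset.expect_le_expect fun m _ => h m

theorem mean_nonneg {f : Matching n → ℝ} (h : ∀ m, 0 ≤ f m) : 0 ≤ mean f :=
  Finset.expect_nonneg fun m _ => h m

theorem abs_mean_le (f : Matching n → ℝ) : |mean f| ≤ mean fun m => |f m| :=
  Finset.abs_expect_le _ _

theorem mean_congr {f g : Matching n → ℝ} (h : ∀ m, f m = g m) : mean f = mean g := by
  rw [funext h]

/-- The probability of an event for a uniform random matching of size `n`. -/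
noncomputable def prob (p : Matching n → Prop) : ℝ := mean fun m => ind (p m)

theorem prob_nonneg (p : Matching n → Prop) : 0 ≤ prob p := mean_nonneg fun _ => ind_nonneg _

theorem prob_mono {p q : Matching n → Prop} (h : ∀ m, p m → q m) : prob p ≤ prob q :=
  mean_mono fun m => ind_mono (h m)

theorem prob_le_one (p : Matching n → Prop) : prob p ≤ 1 :=
  (mean_mono fun _ => ind_le_one _).trans_eq (mean_const 1)

theorem prob_or_le (p q : Matching n → Prop) : prob (fun m => p m ∨ q m) ≤ prob p + prob q :=
  (mean_mono fun _ => ind_or_le _ _).trans_eq (mean_add _ _)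

theorem prob_exists_le {ι : Type*} (s : Finset ι) (p : ι → Matching n → Prop) :
    prob (fun m => ∃ i ∈ s, p i m) ≤ ∑ i ∈ s, prob (p i) :=
  (mean_mono fun _ => ind_exists_le s _).trans_eq (mean_sum s _)

theorem prob_eq_zero {p : Matching n → Prop} (h : ∀ m, ¬ p m) : prob p = 0 := by
  unfold prob
  rw [mean_congr fun m => ind_of_not (h m), mean_const]

theorem prob_not (p : Matching n → Prop) : prob (fun m => ¬ p m) = 1 - prob p := by
  unfold prob
  rw [← mean_const (n := n) 1, ← mean_sub]
  refine mean_congr fun m => ?_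
  by_cases h : p m <;> simp [ind, h]

theorem real_uniformMatching (p : Matching n → Prop) :
    (uniformMatching n).real {m | p m} = prob p := by
  classical
  have h := uniformOn_univ (Ω := Matching n) (s := {m | p m})
  rw [measureReal_def, uniformMatching, h, Measure.count_apply (Set.toFinite _).measurableSet]
  unfold prob mean
  rw [Fintype.expect_eq_sum_div_card, ← card_filter_eq_sum_ind, ENNReal.toReal_div]
  congr 1
  rw [Set.encard_eq_coe_toFinset_card]
  simp

/-- The matching obtained by relabelling the points along `σ`. -/
def conj (σ : Equiv.Perm (Fin (2 * n))) (m : Matching n) : Matching n :=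
  ⟨fun i => σ (m (σ.symm i)), fun i => by simp [apply_apply], fun i h => m.apply_ne (σ.symm i) <| by
    rw [Equiv.eq_symm_apply]; exact h⟩

theorem conj_apply (σ : Equiv.Perm (Fin (2 * n))) (m : Matching n) (i : Fin (2 * n)) :
    conj σ m i = σ (m (σ.symm i)) := rfl

/-- Relabelling as a permutation of the set of matchings. -/
def conjEquiv (σ : Equiv.Perm (Fin (2 * n))) : Matching n ≃ Matching n where
  toFun := conj σ
  invFun := conj σ.symm
  left_inv m := ext' fun i => by simp [conj_apply]
  right_inv m := ext' fun i => by simp [conj_apply]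

theorem mean_conj (σ : Equiv.Perm (Fin (2 * n))) (f : Matching n → ℝ) :
    mean (fun m => f (conj σ m)) = mean f :=
  Fintype.expect_equiv (conjEquiv σ) _ _ fun _ => rfl

/-- If an event depends only on the way in which the points of `S` are used, then adding a chord
off `S` costs at least a factor `2n - 1 - |S|`. -/
theorem prob_and_apply_eq_le (E : Matching n → Prop) (S : Finset (Fin (2 * n)))
    (hE : ∀ σ : Equiv.Perm (Fin (2 * n)), (∀ s ∈ S, σ s = s) → ∀ m, E (conj σ m) → E m)
    {a b : Fin (2 * n)} (ha : a ∉ S) (hb : b ∉ S) (hab : a ≠ b) :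
    prob (fun m => E m ∧ m a = b) * (2 * n - 1 - S.card) ≤ prob E := by
  classical
  set B := (insert a S)ᶜ with hB
  have hBc : (B.card : ℝ) = 2 * n - 1 - S.card := by
    rw [hB, Finset.card_compl, Finset.card_insert_of_notMem ha, Fintype.card_fin, Nat.cast_sub]
    · push_cast; ring
    · rw [← Finset.card_insert_of_notMem ha]
      simpa using Finset.card_le_univ (insert a S)
  -- The transposition of `b` and `u` fixes `a` and every point of `S`, so it carries the event with
  -- chord {a, b} into the one with chord {a, u}. The latter events are disjoint and contained in
  -- `E`.
  have h1 : ∀ u ∈ B, prob (fun m => E m ∧ m a = b) ≤ prob (fun m => E m ∧ m a = u) := by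
    intro u hu
    simp only [hB, Finset.mem_compl, Finset.mem_insert, not_or] at hu
    unfold prob
    rw [← mean_conj (Equiv.swap b u)]
    refine mean_mono fun m => ind_mono fun h => ⟨hE (Equiv.swap b u) ?_ m h.1, ?_⟩
    · intro s hs
      exact Equiv.swap_apply_of_ne_of_ne (fun h => hb (h ▸ hs)) (fun h => hu.2 (h ▸ hs))
    · have h2 := h.2
      rw [conj_apply, Equiv.symm_swap, Equiv.swap_apply_of_ne_of_ne hab (Ne.symm hu.1),
        Equiv.swap_apply_eq_iff, Equiv.swap_apply_left] at h2
      exact h2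
  rw [← hBc, mul_comm, ← nsmul_eq_mul, ← Finset.sum_const]
  refine (Finset.sum_le_sum h1).trans ?_
  unfold prob
  rw [← mean_sum]
  refine mean_mono fun m => ?_
  by_cases h : E m
  · rw [ind_of h]
    calc ∑ i ∈ B, ind (E m ∧ m a = i) ≤ ∑ i, ind (m a = i) * 1 := by
          refine (Finset.sum_le_univ_sum_of_nonneg fun i => ind_nonneg _).trans ?_
          exact Finset.sum_le_sum fun i _ => by rw [mul_one]; exact ind_mono And.right
      _ = 1 := sum_ind_mul _ _
  · rw [Finset.sum_eq_zero]
    · exact ind_nonneg _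
    · intro i _
      exact ind_of_not fun h' => h h'.1

/-- Join `a` to `b`, and join to each other the points which were joined to `a` and `b`. -/
def join (a b : Fin (2 * n)) (m : Matching n) : Matching n := conj (Equiv.swap b (m a)) m

theorem join_apply_left {a b : Fin (2 * n)} (hab : a ≠ b) (m : Matching n) : join a b m a = b := by
  rw [join, conj_apply, Equiv.symm_swap,
    Equiv.swap_apply_of_ne_of_ne hab (m.apply_ne a).symm, Equiv.swap_apply_right]

theorem join_of_apply_eq {a b : Fin (2 * n)} {m : Matching n} (h : m a = b) : join a b m = m := by
  refine ext' fun i => ?_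
  rw [join, conj_apply, h]
  simp

theorem conj_swap_apply_of_notMem {S : Finset (Fin (2 * n))} {m : Matching n}
    (hS : ∀ p ∈ S, m p ∈ S) {x y : Fin (2 * n)} (hx : x ∉ S) (hy : y ∉ S) {p : Fin (2 * n)}
    (hp : p ∈ S) : conj (Equiv.swap x y) m p = m p := by
  have key : ∀ q ∈ S, Equiv.swap x y q = q := fun q hq =>
    Equiv.swap_apply_of_ne_of_ne (fun h => hx (h ▸ hq)) (fun h => hy (h ▸ hq))
  rw [conj_apply, Equiv.symm_swap, key p hp, key _ (hS p hp)]

theorem conj_swap_join (a b : Fin (2 * n)) (m : Matching n) :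
    conj (Equiv.swap b (m a)) (join a b m) = m :=
  ext' fun i => by simp [join, conj_apply]

/-- On the matchings with `m a = u`, relabelling by the transposition of `b` and `u` is a bijection
onto those with `m a = b`. Thus the former partner of `a` is uniform over the other points and
independent of the switched matching. -/
theorem mean_join {a b : Fin (2 * n)} (hab : a ≠ b) (F : Matching n → Fin (2 * n) → ℝ) :
    mean (fun m => F (join a b m) (m a)) =
      ∑ u ∈ Finset.univ.erase a, mean (fun m => ind (m a = b) * F m u) := by
  have h1 : ∀ m : Matching n, F (join a b m) (m a) =
      ∑ u ∈ Finset.univ.erase a, ind (m a = u) * F (conj (Equiv.swap b u) m) u := by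
    intro m
    have h := sum_ind_mul (m a) (fun u => F (conj (Equiv.swap b u) m) u)
    rw [← Finset.add_sum_erase _ _ (Finset.mem_univ a), ind_of_not (m.apply_ne a), zero_mul,
      zero_add] at h
    exact h.symm
  rw [mean_congr h1, mean_sum]
  refine Finset.sum_congr rfl fun u hu => ?_
  rw [← mean_conj (Equiv.swap b u) (fun m => ind (m a = b) * F m u)]
  refine mean_congr fun m => ?_
  congr 1
  refine ind_congr ?_
  rw [conj_apply, Equiv.symm_swap, Equiv.swap_apply_of_ne_of_ne hab (Finset.ne_of_mem_erase hu).symm,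
    Equiv.swap_apply_eq_iff, Equiv.swap_apply_left]

/-- The same switching among matchings that already contain {a, b}: the former partner of `c` avoids
`a`, `b` and `c`, and the chord {a, b} survives. -/
theorem mean_join_of_apply_eq {a b c d : Fin (2 * n)} (hcd : c ≠ d) (hac : a ≠ c) (had : a ≠ d)
    (hbc : b ≠ c) (hbd : b ≠ d) (F : Matching n → Fin (2 * n) → ℝ) :
    mean (fun m => ind (m a = b) * F (join c d m) (m c)) =
      ∑ u ∈ ((Finset.univ.erase a).erase b).erase c,
        mean (fun m => ind (m a = b ∧ m c = d) * F m u) := by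
  classical
  -- The extra indicator costs nothing: if `c` is joined to `a` or `b`, the chord {a, b} is absent,
  -- because `c` is neither of them.
  obtain ⟨G, hG⟩ : ∃ G : Matching n → Fin (2 * n) → ℝ,
      ∀ m u, G m u = ind (u ≠ a ∧ u ≠ b) * ind (m a = b) * F m u := ⟨_, fun _ _ => rfl⟩
  have h1 : ∀ m : Matching n,
      ind (m a = b) * F (join c d m) (m c) = G (join c d m) (m c) := by
    intro m
    rw [hG]
    by_cases hu : m c ≠ a ∧ m c ≠ b
    · rw [ind_of hu, one_mul]
      congr 1
      refine ind_congr ?_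
      rw [join, conj_apply, Equiv.symm_swap, Equiv.swap_apply_of_ne_of_ne had hu.1.symm,
        Equiv.swap_apply_eq_iff, Equiv.swap_apply_of_ne_of_ne hbd hu.2.symm]
    · rw [ind_of_not hu, zero_mul, zero_mul, ind_of_not, zero_mul]
      intro h
      apply hu
      constructor
      · intro h'
        exact hbc (h ▸ (m.apply_eq_comm.1 h'))
      · intro h'
        exact hac (m.injective (h.trans h'.symm))
  refine (mean_congr h1).trans ((mean_join hcd G).trans ?_)
  have hs : ((Finset.univ.erase a).erase b).erase c =
      (Finset.univ.erase c).filter fun u => u ≠ a ∧ u ≠ b := by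
    ext u; simp; tauto
  rw [hs, Finset.sum_filter]
  refine Finset.sum_congr rfl fun u hu => ?_
  simp only [hG]
  by_cases hu' : u ≠ a ∧ u ≠ b
  · rw [if_pos hu', ind_of hu']
    refine mean_congr fun m => ?_
    rw [ind_and]; ring
  · rw [if_neg hu', ind_of_not hu']
    simp [mean_const]

end Matching

/-! ### Neighbours on the circle, patterns, and the patterns through a point -/

namespace Matching

variable {n : ℕ}

theorem next_val (i : Fin (2 * n)) :
    (next i : ℕ) = if (i : ℕ) + 1 = 2 * n then 0 else (i : ℕ) + 1 := by
  have := i.isLt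
  unfold next
  split_ifs with h
  · simp [h]
  · exact Nat.mod_eq_of_lt (by omega)

/-- The point `i - 1` modulo `2n`. -/
def prev (i : Fin (2 * n)) : Fin (2 * n) :=
  ⟨if (i : ℕ) = 0 then 2 * n - 1 else (i : ℕ) - 1, by have := i.isLt; split_ifs <;> omega⟩

theorem prev_val (i : Fin (2 * n)) :
    (prev i : ℕ) = if (i : ℕ) = 0 then 2 * n - 1 else (i : ℕ) - 1 := rfl

theorem prev_next (i : Fin (2 * n)) : prev (next i) = i := by
  have := i.isLt
  rw [Fin.ext_iff, prev_val, next_val]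
  by_cases h : (i : ℕ) + 1 = 2 * n
  · rw [if_pos h, if_pos rfl]; omega
  · rw [if_neg h, if_neg (by omega)]; omega

theorem next_prev (i : Fin (2 * n)) : next (prev i) = i := by
  have := i.isLt
  rw [Fin.ext_iff, next_val, prev_val]
  split_ifs <;> omega

theorem next_injective : Function.Injective (next : Fin (2 * n) → Fin (2 * n)) :=
  Function.LeftInverse.injective prev_next

theorem next_inj {i j : Fin (2 * n)} : next i = next j ↔ i = j := next_injective.eq_iff

theorem next_ne (i : Fin (2 * n)) : next i ≠ i := by
  have := i.isLt
  rw [Ne, Fin.ext_iff, next_val]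
  split_ifs <;> omega

theorem next_next_ne (hn : 2 ≤ n) (i : Fin (2 * n)) : next (next i) ≠ i := by
  have := i.isLt
  rw [Ne, Fin.ext_iff, next_val, next_val]
  split_ifs <;> omega

theorem next_next_next_ne (hn : 2 ≤ n) (i : Fin (2 * n)) : next (next (next i)) ≠ i := by
  have := i.isLt
  rw [Ne, Fin.ext_iff, next_val, next_val, next_val]
  split_ifs <;> omega

theorem next_next_next_next_ne (hn : 3 ≤ n) (i : Fin (2 * n)) :
    next (next (next (next i))) ≠ i := by
  have := i.isLt
  rw [Ne, Fin.ext_iff, next_val, next_val, next_val, next_val]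
  split_ifs <;> omega

theorem prev_eq_iff {i j : Fin (2 * n)} : prev i = j ↔ i = next j := by
  constructor
  · rintro rfl; exact (next_prev i).symm
  · rintro rfl; exact prev_next j

/-- The indices of the patterns counted by `countX`, `countY` and `countZ`: the first component is
the kind of pattern, the others are its base points. -/
abbrev Pattern (n : ℕ) : Type := Fin 3 × Fin (2 * n) × Fin (2 * n)

namespace Pattern

/-- The index corresponds to a pattern. -/
def Valid (α : Pattern n) : Prop :=
  (α.1 = 0 ∧ α.2.2 = next α.2.1) ∨ (α.1 = 1 ∧ α.2.2 = next (next α.2.1)) ∨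
    (α.1 = 2 ∧ α.2.2 ≠ α.2.1 ∧ α.2.2 ≠ next α.2.1 ∧ α.2.1 ≠ next α.2.2)

/-- The first point of the first chord of a pattern. The chords are `{a, b}` and `{c, d}`; they
agree for patterns with one chord. -/
def a (α : Pattern n) : Fin (2 * n) := α.2.1

/-- The second point of the first chord of a pattern. -/
def b (α : Pattern n) : Fin (2 * n) := if α.1 = 2 ∧ α.2.2 < α.2.1 then next α.2.2 else α.2.2

/-- The first point of the last chord of a pattern. -/
def c (α : Pattern n) : Fin (2 * n) := if α.1 = 2 then next α.2.1 else α.2.1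

/-- The second point of the last chord of a pattern. -/
def d (α : Pattern n) : Fin (2 * n) :=
  if α.1 = 2 ∧ ¬ α.2.2 < α.2.1 then next α.2.2 else α.2.2

/-- The points used by a pattern. -/
def pts (α : Pattern n) : Finset (Fin (2 * n)) := {α.a, α.b, α.c, α.d}

/-- The pattern is contained in the matching `m`. -/
def Occurs (α : Pattern n) (m : Matching n) : Prop := m α.a = α.b ∧ m α.c = α.d

theorem Occurs.apply_mem {α : Pattern n} {m : Matching n} (h : α.Occurs m) {p : Fin (2 * n)}
    (hp : p ∈ α.pts) : m p ∈ α.pts := by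
  obtain ⟨h1, h2⟩ := h
  have h3 := m.apply_eq_comm.1 h1
  have h4 := m.apply_eq_comm.1 h2
  simp only [pts, Finset.mem_insert, Finset.mem_singleton] at hp ⊢
  rcases hp with rfl | rfl | rfl | rfl <;> simp [h1, h2, h3, h4]

theorem card_pts_le (α : Pattern n) : α.pts.card ≤ 4 := Finset.card_le_four

theorem a_mem_pts (α : Pattern n) : α.a ∈ α.pts := by simp [pts]

/-- The pattern is a pair of chords. -/
def IsDouble (α : Pattern n) : Prop := α.1 = 2

theorem a_ne_b {α : Pattern n} (hn : 2 ≤ n) (h : α.Valid) : α.a ≠ α.b := by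
  rcases h with ⟨h0, h1⟩ | ⟨h0, h1⟩ | ⟨h0, h1, h2, h3⟩
  · simp [a, b, h0, h1, (next_ne _).symm]
  · simp [a, b, h0, h1, (next_next_ne hn _).symm]
  · simp only [a, b]
    split_ifs
    · exact h3
    · exact h1.symm

theorem c_eq_d_eq {α : Pattern n} (h : ¬ α.IsDouble) : α.c = α.a ∧ α.d = α.b := by
  simp only [IsDouble] at h
  simp [a, b, c, d, h]

theorem distinct_of_isDouble {α : Pattern n} (h : α.Valid) (h2 : α.IsDouble) :
    α.c ≠ α.d ∧ α.a ≠ α.c ∧ α.a ≠ α.d ∧ α.b ≠ α.c ∧ α.b ≠ α.d := by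
  simp only [IsDouble] at h2
  rcases h with ⟨h0, -⟩ | ⟨h0, -⟩ | ⟨h0, h1, h2, h3⟩
  · rw [h2] at h0; simp at h0
  · rw [h2] at h0; simp at h0
  · simp only [a, b, c, d, h0, true_and, if_true]
    have h4 : next α.2.1 ≠ next α.2.2 := fun h => h1 (next_inj.1 h).symm
    split_ifs with h5
    · exact ⟨h2.symm, (next_ne _).symm, h1.symm, h4.symm, next_ne _⟩
    · exact ⟨h4, (next_ne _).symm, h3, h2, (next_ne _).symm⟩

end Pattern

open Classical in
/-- The set of indices of patterns. -/
noncomputable def patternIndices (n : ℕ) : Finset (Pattern n) :=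
  Finset.univ.filter Pattern.Valid

open Classical in
/-- The set of patterns contained in a matching. -/
noncomputable def patterns (m : Matching n) : Finset (Pattern n) :=
  (patternIndices n).filter fun α => α.Occurs m

theorem mem_patternIndices {α : Pattern n} : α ∈ patternIndices n ↔ α.Valid := by
  simp [patternIndices]

theorem mem_patterns {m : Matching n} {α : Pattern n} :
    α ∈ patterns m ↔ α.Valid ∧ α.Occurs m := by
  simp [patterns, mem_patternIndices]

/-- The neighbour of `p` on the side given by `e`. -/
def step (e : Bool) (p : Fin (2 * n)) : Fin (2 * n) := if e then next p else prev p

/-- The first point of the pair `{p, step e p}` of consecutive points. -/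
def pairBase (e : Bool) (p : Fin (2 * n)) : Fin (2 * n) := if e then p else prev p

/-- The point at distance one or two from `p`, on the side given by `s`. -/
def jump (t s : Bool) (p : Fin (2 * n)) : Fin (2 * n) := if t then step s p else step s (step s p)

/-- The candidates for the patterns using the point `p` of a matching. -/
def candidate (m : Matching n) (p : Fin (2 * n)) : Bool × Bool × Bool → Pattern n
  | (true, t, s) => (if t then 0 else 1, if s then (p, jump t s p) else (jump t s p, p))
  | (false, e, f) =>
    (2, if e = f then (min (pairBase e p) (pairBase f (m p)), max (pairBase e p) (pairBase f (m p)))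
      else (max (pairBase e p) (pairBase f (m p)), min (pairBase e p) (pairBase f (m p))))

/-- The necessary condition under which a candidate occurs. -/
def CandidateOccurs (m : Matching n) (p : Fin (2 * n)) : Bool × Bool × Bool → Prop
  | (true, t, s) => m p = jump t s p
  | (false, e, f) => m (step e p) = step f (m p) ∧ step e p ≠ m p

-- A one-chord pattern through `p` is known from its length and the side of `p` on which it lies. In
-- a two-chord pattern the other chord joins a neighbour of `p` to a neighbour of `m p`; whether the
-- two sides agree decides in which order the base points are recorded.
set_option linter.unusedSimpArgs false in
theorem exists_candidate {m : Matching n} {α : Pattern n} (h : α ∈ patterns m) {p : Fin (2 * n)}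
    (hp : p ∈ α.pts) : ∃ c, α = candidate m p c ∧ CandidateOccurs m p c := by
  obtain ⟨hv, ho⟩ := mem_patterns.1 h
  obtain ⟨t, k, l⟩ := α
  have hdist := Pattern.distinct_of_isDouble hv
  obtain ⟨h1, h2⟩ := ho
  have h3 := m.apply_eq_comm.1 h1
  have h4 := m.apply_eq_comm.1 h2
  simp only [Pattern.pts, Finset.mem_insert, Finset.mem_singleton] at hp
  rcases hv with ⟨ht, hl⟩ | ⟨ht, hl⟩ | ⟨ht, hl⟩ <;> simp only at ht hl <;> subst ht
  · subst hl
    simp only [Pattern.a, Pattern.b, Pattern.c, Pattern.d] at *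
    simp at h1 h3 hp
    replace hp : p = k ∨ p = next k := by tauto
    rcases hp with rfl | rfl
    · exact ⟨(true, true, true), by simp [candidate, jump, step], by
        simp [CandidateOccurs, jump, step, h1]⟩
    · exact ⟨(true, true, false), by simp [candidate, jump, step, prev_next], by
        simp [CandidateOccurs, jump, step, h3, prev_next]⟩
  · subst hl
    simp only [Pattern.a, Pattern.b, Pattern.c, Pattern.d] at *
    simp at h1 h3 hp
    replace hp : p = k ∨ p = next (next k) := by tauto
    rcases hp with rfl | rfl
    · exact ⟨(true, false, true), by simp [candidate, jump, step], by
        simp [CandidateOccurs, jump, step, h1]⟩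
    · exact ⟨(true, false, false), by simp [candidate, jump, step, prev_next], by
        simp [CandidateOccurs, jump, step, h3, prev_next]⟩
  · obtain ⟨hcd, hac, had, hbc, hbd⟩ := hdist rfl
    simp only [Pattern.a, Pattern.b, Pattern.c, Pattern.d, true_and, if_true] at *
    by_cases hlt : l < k
    · have e1 : min k l = l := min_eq_right hlt.le
      have e2 : max k l = k := max_eq_left hlt.le
      have e3 : min l k = l := min_eq_left hlt.le
      have e4 : max l k = k := max_eq_right hlt.le
      simp only [hlt, if_true, not_true, if_false] at *
      rcases hp with rfl | rfl | rfl | rfl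
      · refine ⟨(false, true, false), ?_, ?_⟩ <;>
          simp [candidate, CandidateOccurs, step, pairBase, prev_next, h1, h2, h3, h4, e1, e2,
            hbc.symm, hac, had, hbd]
      · refine ⟨(false, false, true), ?_, ?_⟩ <;>
          simp [candidate, CandidateOccurs, step, pairBase, prev_next, h1, h2, h3, h4, e3, e4,
            had.symm]
      · refine ⟨(false, false, true), ?_, ?_⟩ <;>
          simp [candidate, CandidateOccurs, step, pairBase, prev_next, h1, h2, h3, h4, e1, e2,
            had]
      · refine ⟨(false, true, false), ?_, ?_⟩ <;>
          simp [candidate, CandidateOccurs, step, pairBase, prev_next, h1, h2, h3, h4, e3, e4,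
            hbc]
    · have e1 : min k l = k := min_eq_left (not_lt.1 hlt)
      have e2 : max k l = l := max_eq_right (not_lt.1 hlt)
      have e3 : min l k = k := min_eq_right (not_lt.1 hlt)
      have e4 : max l k = l := max_eq_left (not_lt.1 hlt)
      simp only [hlt, if_true, not_false_iff, if_false] at *
      rcases hp with rfl | rfl | rfl | rfl
      · refine ⟨(false, true, true), ?_, ?_⟩ <;>
          simp [candidate, CandidateOccurs, step, pairBase, prev_next, h1, h2, h3, h4, e1, e2,
            hbc.symm]
      · refine ⟨(false, true, true), ?_, ?_⟩ <;>
          simp [candidate, CandidateOccurs, step, pairBase, prev_next, h1, h2, h3, h4, e3, e4,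
            had.symm]
      · refine ⟨(false, false, false), ?_, ?_⟩ <;>
          simp [candidate, CandidateOccurs, step, pairBase, prev_next, h1, h2, h3, h4, e1, e2,
            had]
      · refine ⟨(false, false, false), ?_, ?_⟩ <;>
          simp [candidate, CandidateOccurs, step, pairBase, prev_next, h1, h2, h3, h4, e3, e4,
            hbc]

open Classical in
theorem card_patterns_filter_mem_le (m : Matching n) (p : Fin (2 * n)) :
    ((patterns m).filter fun α => p ∈ α.pts).card ≤ 8 := by
  refine (Finset.card_le_card (t := Finset.univ.image (candidate m p)) ?_).trans
    (Finset.card_image_le.trans_eq (by simp))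
  intro α hα
  obtain ⟨hα, hp⟩ := Finset.mem_filter.1 hα
  obtain ⟨c, rfl, -⟩ := exists_candidate hα hp
  exact Finset.mem_image_of_mem _ (Finset.mem_univ c)

end Matching

/-! ### Moment bounds for patterns through a point -/

namespace Matching

variable {n : ℕ}

/-- With at most four points in `S`, the factor 2n-1-|S| is at least 2n-5, hence at least n once n ≥
5. -/
theorem prob_and_apply_eq_le_div (hn : 5 ≤ n) (E : Matching n → Prop) (S : Finset (Fin (2 * n)))
    (hS : S.card ≤ 4)
    (hE : ∀ σ : Equiv.Perm (Fin (2 * n)), (∀ s ∈ S, σ s = s) → ∀ m, E (conj σ m) → E m)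
    {a b : Fin (2 * n)} (ha : a ∉ S) (hb : b ∉ S) (hab : a ≠ b) :
    prob (fun m => E m ∧ m a = b) ≤ prob E / n := by
  have hn' : (5 : ℝ) ≤ n := by exact_mod_cast hn
  have hS' : (S.card : ℝ) ≤ 4 := by exact_mod_cast hS
  rw [le_div_iff₀ (by linarith)]
  refine le_trans ?_ (prob_and_apply_eq_le E S hE ha hb hab)
  exact mul_le_mul_of_nonneg_left (by linarith) (prob_nonneg _)

theorem conj_apply_eq_iff {σ : Equiv.Perm (Fin (2 * n))} {m : Matching n} {a b : Fin (2 * n)}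
    (ha : σ a = a) (hb : σ b = b) : conj σ m a = b ↔ m a = b := by
  rw [conj_apply, ← Equiv.eq_symm_apply, σ.symm_apply_eq.2 ha.symm, σ.symm_apply_eq.2 hb.symm]

theorem prob_apply_eq_le (hn : 5 ≤ n) (a b : Fin (2 * n)) :
    prob (fun m => m a = b) ≤ 1 / n := by
  by_cases hab : a = b
  · rw [prob_eq_zero fun m h => m.apply_ne a (h.trans hab.symm)]
    positivity
  · have h := prob_and_apply_eq_le_div hn (fun _ => True) ∅ (by simp) (fun _ _ _ h => h)
      (Finset.notMem_empty a) (Finset.notMem_empty b) hab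
    refine (prob_mono fun m hm => ⟨trivial, hm⟩).trans (h.trans ?_)
    gcongr
    exact prob_le_one _

/-- If `d` is one of `a`, `b`, `c` the event is empty, so only the position of `c` has to be
controlled. -/
theorem prob_two_apply_eq_le (hn : 5 ≤ n) {a b c d : Fin (2 * n)} (hca : c ≠ a) (hcb : c ≠ b) :
    prob (fun m => m a = b ∧ m c = d) ≤ 1 / n ^ 2 := by
  have h0 : (0 : ℝ) ≤ 1 / (n : ℝ) ^ 2 := by positivity
  by_cases hda : d = a
  · rw [prob_eq_zero]
    · exact h0
    · rintro m ⟨h1, h2⟩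
      exact hcb ((m.apply_eq_comm.1 (h2.trans hda)).symm.trans h1)
  by_cases hdb : d = b
  · rw [prob_eq_zero]
    · exact h0
    · rintro m ⟨h1, h2⟩
      exact hca (m.injective (h2.trans (hdb.trans h1.symm)))
  by_cases hcd : c = d
  · rw [prob_eq_zero]
    · exact h0
    · rintro m ⟨h1, h2⟩
      exact m.apply_ne c (h2.trans hcd.symm)
  have h := prob_and_apply_eq_le_div hn (fun m => m a = b) {a, b}
    (Finset.card_le_two.trans (by norm_num))
    (fun σ hσ m h => (conj_apply_eq_iff (hσ a (by simp)) (hσ b (by simp))).1 h)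
    (a := c) (b := d) (by simp [hca, hcb]) (by simp [hda, hdb]) hcd
  refine h.trans ?_
  calc prob (fun m => m a = b) / n ≤ (1 / n) / n := by gcongr; exact prob_apply_eq_le hn a b
    _ = 1 / n ^ 2 := by rw [div_div, sq]

theorem prob_three_apply_eq_le (hn : 5 ≤ n) {a b c d e f : Fin (2 * n)} (hca : c ≠ a)
    (hcb : c ≠ b) (hea : e ≠ a) (heb : e ≠ b) (hec : e ≠ c) (hed : e ≠ d) :
    prob (fun m => (m a = b ∧ m c = d) ∧ m e = f) ≤ 1 / n ^ 3 := by
  have h0 : (0 : ℝ) ≤ 1 / (n : ℝ) ^ 3 := by positivity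
  by_cases hf : f = a ∨ f = b ∨ f = c ∨ f = d ∨ e = f
  · rw [prob_eq_zero]
    · exact h0
    · rintro m ⟨⟨h1, h2⟩, h3⟩
      rcases hf with h | h | h | h | h
      · exact heb ((m.apply_eq_comm.1 (h3.trans h)).symm.trans h1)
      · exact hea (m.injective (h3.trans (h.trans h1.symm)))
      · exact hed ((m.apply_eq_comm.1 (h3.trans h)).symm.trans h2)
      · exact hec (m.injective (h3.trans (h.trans h2.symm)))
      · exact m.apply_ne e (h3.trans h.symm)
  simp only [not_or] at hf
  have h := prob_and_apply_eq_le_div hn (fun m => m a = b ∧ m c = d) {a, b, c, d}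
    Finset.card_le_four
    (fun σ hσ m h => ⟨(conj_apply_eq_iff (hσ a (by simp)) (hσ b (by simp))).1 h.1,
      (conj_apply_eq_iff (hσ c (by simp)) (hσ d (by simp))).1 h.2⟩)
    (a := e) (b := f) (by simp [hea, heb, hec, hed]) (by simp [hf]) hf.2.2.2.2
  refine h.trans ?_
  calc prob (fun m => m a = b ∧ m c = d) / n ≤ (1 / n ^ 2) / n := by
        gcongr; exact prob_two_apply_eq_le hn hca hcb
    _ = 1 / n ^ 3 := by rw [div_div, ← pow_succ]

theorem step_ne (e : Bool) (p : Fin (2 * n)) : step e p ≠ p := by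
  cases e
  · simpa [step, prev_eq_iff] using (next_ne p).symm
  · simpa [step] using next_ne p

/-- Union bound over the 2n possible partners of `p`; this loses one power of n. -/
theorem prob_exists_apply_eq_le (hn : 0 < n) (p : Fin (2 * n)) (E : Matching n → Fin (2 * n) → Prop)
    (k : ℕ) (h : ∀ q, prob (fun m => m p = q ∧ E m q) ≤ 1 / n ^ (k + 1)) :
    prob (fun m => E m (m p)) ≤ 2 / n ^ k := by
  have hn' : (0 : ℝ) < n := by exact_mod_cast hn
  calc prob (fun m => E m (m p))
      ≤ prob (fun m => ∃ q ∈ Finset.univ, m p = q ∧ E m q) :=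
        prob_mono fun m hm => ⟨m p, Finset.mem_univ _, rfl, hm⟩
    _ ≤ ∑ q : Fin (2 * n), prob (fun m => m p = q ∧ E m q) := prob_exists_le _ _
    _ ≤ ∑ _q : Fin (2 * n), 1 / (n : ℝ) ^ (k + 1) := Finset.sum_le_sum fun q _ => h q
    _ = 2 / n ^ k := by
        rw [Finset.sum_const, Finset.card_univ, Fintype.card_fin, nsmul_eq_mul]
        push_cast
        rw [pow_succ]
        field_simp

theorem prob_candidateOccurs_le (hn : 5 ≤ n) (p : Fin (2 * n)) (c : Bool × Bool × Bool) :
    prob (fun m => CandidateOccurs m p c) ≤ 2 / n := by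
  obtain ⟨_ | _, e, f⟩ := c
  · have h := prob_exists_apply_eq_le (by omega) p
      (fun m q => m (step e p) = step f q ∧ step e p ≠ q) 1 ?_
    · rw [pow_one] at h
      exact h
    · intro q
      by_cases hq : step e p = q
      · rw [prob_eq_zero fun m hm => hm.2.2 hq]
        positivity
      · refine (prob_mono ?_).trans (prob_two_apply_eq_le hn (a := p) (b := q) (d := step f q)
          (step_ne e p) hq)
        exact fun m hm => ⟨hm.1, hm.2.1⟩
  · refine (prob_apply_eq_le hn p (jump e f p)).trans ?_
    gcongr
    norm_num

theorem jump_injective (hn : 3 ≤ n) {p : Fin (2 * n)} {t s t' s' : Bool}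
    (h : jump t s p = jump t' s' p) : t = t' ∧ s = s' := by
  obtain ⟨q, rfl⟩ : ∃ q, p = next (next q) := ⟨prev (prev p), by simp [next_prev]⟩
  have h1 := next_ne q
  have h2 := next_next_ne (by omega : 2 ≤ n) q
  have h3 := next_next_next_ne (by omega : 2 ≤ n) q
  have h4 := next_next_next_next_ne hn q
  cases t <;> cases s <;> cases t' <;> cases s' <;>
    simp only [jump, step, prev_next, if_true, Bool.false_eq_true, if_false, next_inj] at h <;>
    first
    | exact ⟨rfl, rfl⟩
    | exact absurd h h1
    | exact absurd h h2
    | exact absurd h h3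
    | exact absurd h h4
    | exact absurd h.symm h1
    | exact absurd h.symm h2
    | exact absurd h.symm h3
    | exact absurd h.symm h4

theorem step_eq_step (hn : 2 ≤ n) {p : Fin (2 * n)} {e e' : Bool} (h : step e p = step e' p) :
    e = e' := by
  have := next_next_ne hn (prev p)
  rw [next_prev] at this
  cases e <;> cases e' <;> simp_all [step]

/-- Two one-chord candidates exclude each other. A one-chord and a two-chord candidate prescribe two
chords. Two two-chord candidates prescribe three chords once the partner of `p` is fixed, and there
are 2n choices of that partner. -/
theorem prob_two_candidateOccurs_le (hn : 5 ≤ n) (p : Fin (2 * n)) {c c' : Bool × Bool × Bool}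
    (hc : c ≠ c') :
    prob (fun m => CandidateOccurs m p c ∧ CandidateOccurs m p c') ≤ 2 / n ^ 2 := by
  have h0 : (0 : ℝ) ≤ 2 / (n : ℝ) ^ 2 := by positivity
  have hle : 1 / (n : ℝ) ^ 2 ≤ 2 / (n : ℝ) ^ 2 := by gcongr; norm_num
  have mixed : ∀ t s e f, prob (fun m : Matching n => m p = jump t s p ∧
      m (step e p) = step f (m p) ∧ step e p ≠ m p) ≤ 2 / n ^ 2 := by
    intro t s e f
    by_cases hq : step e p = jump t s p
    · rw [prob_eq_zero]
      · exact h0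
      · rintro m ⟨h1, -, h2⟩
        exact h2 (hq.trans h1.symm)
    · refine (prob_mono ?_).trans ((prob_two_apply_eq_le hn (a := p) (b := jump t s p)
        (d := step f (jump t s p)) (step_ne e p) hq).trans hle)
      rintro m ⟨h1, h2, -⟩
      exact ⟨h1, by rw [h2, h1]⟩
  obtain ⟨_ | _, e, f⟩ := c <;> obtain ⟨_ | _, e', f'⟩ := c'
  · refine prob_exists_apply_eq_le (by omega) p (fun m q =>
      (m (step e p) = step f q ∧ step e p ≠ q) ∧ (m (step e' p) = step f' q ∧ step e' p ≠ q)) 2 ?_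
    intro q
    by_cases h : (step e p ≠ q ∧ step e' p ≠ q) ∧ step e' p ≠ step e p ∧ step e' p ≠ step f q
    · refine (prob_mono ?_).trans (prob_three_apply_eq_le hn (f := step f' q) (step_ne e p) h.1.1
        (step_ne e' p) h.1.2 h.2.1 h.2.2)
      · rintro m ⟨h1, ⟨h2, -⟩, h3, -⟩
        exact ⟨⟨h1, h2⟩, h3⟩
    · rw [prob_eq_zero]
      · positivity
      rintro m ⟨h1, ⟨h2, h3⟩, h4, h5⟩
      apply h
      refine ⟨⟨h3, h5⟩, ?_, ?_⟩
      · intro h6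
        have h7 := step_eq_step (by omega) h6
        rw [h6, h2] at h4
        have h8 := step_eq_step (by omega) h4
        exact hc (by rw [h7, h8])
      · intro h6
        have h7 : e ≠ e' := by
          rintro rfl
          rw [← h6] at h2
          exact m.apply_ne _ h2
        have h8 : f ≠ f' := by
          rintro rfl
          rw [h6] at h4
          exact m.apply_ne _ h4
        have h9 : step e p = step f' q := by
          rw [← h4, h6, ← h2, apply_apply]
        -- If the candidates share their second chord, then `p` and `q` are equal or at distance two
        -- along both sides of the circle; the latter would make 2n divide 4.
        have h10 := next_next_next_next_ne (by omega : 3 ≤ n)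
        have hpq : p ≠ q := fun h => m.apply_ne p (h1.trans h.symm)
        cases e <;> cases e' <;> cases f <;> cases f' <;> simp [step] at h6 h7 h8 h9
        · rw [prev_eq_iff] at h9
          rw [eq_comm, prev_eq_iff] at h6
          exact h10 q (by rw [h9] at h6; exact h6.symm)
        · exact hpq (next_inj.1 h6)
        · exact hpq (next_inj.1 h9)
        · rw [prev_eq_iff] at h6
          rw [eq_comm, prev_eq_iff] at h9
          exact h10 q (by rw [h6] at h9; exact h9.symm)
  · refine (prob_mono ?_).trans (mixed e' f' e f)
    rintro m ⟨h1, h2⟩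
    exact ⟨h2, h1⟩
  · exact mixed e f e' f'
  · rw [prob_eq_zero]
    · exact h0
    · rintro m ⟨h1, h2⟩
      have := jump_injective (by omega) (h1.symm.trans h2)
      exact hc (by rw [this.1, this.2])

open Classical in
theorem mean_card_filter {ι : Type*} (s : Finset ι) (P : Matching n → ι → Prop) :
    mean (fun m => ((s.filter (P m)).card : ℝ)) = ∑ i ∈ s, prob fun m => P m i := by
  unfold prob
  rw [← mean_sum]
  exact mean_congr fun m => card_filter_eq_sum_ind s (P m)

open Classical in
theorem mean_card_patterns_mem_le (hn : 5 ≤ n) (p : Fin (2 * n)) :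
    mean (fun m => (((patterns m).filter fun α => p ∈ α.pts).card : ℝ)) ≤ 16 / n := by
  calc mean (fun m => (((patterns m).filter fun α => p ∈ α.pts).card : ℝ))
      ≤ mean (fun m => ((Finset.univ.filter (CandidateOccurs m p)).card : ℝ)) := by
        refine mean_mono fun m => Nat.cast_le.2 ?_
        refine (Finset.card_le_card (t := (Finset.univ.filter (CandidateOccurs m p)).image
          (candidate m p)) ?_).trans Finset.card_image_le
        intro α hα
        obtain ⟨hα, hp⟩ := Finset.mem_filter.1 hα
        obtain ⟨c, rfl, hc⟩ := exists_candidate hα hp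
        exact Finset.mem_image_of_mem _ (Finset.mem_filter.2 ⟨Finset.mem_univ c, hc⟩)
    _ = ∑ c, prob fun m => CandidateOccurs m p c := mean_card_filter _ _
    _ ≤ ∑ _c : Bool × Bool × Bool, 2 / (n : ℝ) :=
        Finset.sum_le_sum fun c _ => prob_candidateOccurs_le hn p c
    _ = 16 / n := by
        rw [Finset.sum_const, Finset.card_univ]
        simp
        ring

open Classical in
theorem card_patterns_le_sum (m : Matching n) :
    (patterns m).card ≤ ∑ p, ((patterns m).filter fun α => p ∈ α.pts).card := by
  have h : patterns m ⊆ Finset.univ.biUnion fun p => (patterns m).filter fun α => p ∈ α.pts := by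
    intro α hα
    refine Finset.mem_biUnion.2 ⟨α.a, Finset.mem_univ _, ?_⟩
    exact Finset.mem_filter.2 ⟨hα, α.a_mem_pts⟩
  exact le_trans (Finset.card_le_card h) Finset.card_biUnion_le

theorem mean_card_patterns_le (hn : 5 ≤ n) :
    mean (fun m : Matching n => ((patterns m).card : ℝ)) ≤ 32 := by
  classical
  have hn' : (5 : ℝ) ≤ n := by exact_mod_cast hn
  calc mean (fun m : Matching n => ((patterns m).card : ℝ))
      ≤ mean (fun m : Matching n =>
          ∑ p, (((patterns m).filter fun α => p ∈ α.pts).card : ℝ)) := by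
        refine mean_mono fun m => ?_
        rw [← Nat.cast_sum, Nat.cast_le]
        exact card_patterns_le_sum m
    _ ≤ ∑ _p : Fin (2 * n), 16 / (n : ℝ) := by
        rw [mean_sum]
        exact Finset.sum_le_sum fun p _ => mean_card_patterns_mem_le hn p
    _ = 32 := by
        rw [Finset.sum_const, Finset.card_univ, Fintype.card_fin, nsmul_eq_mul]
        push_cast
        field_simp
        norm_num

/-- Two different candidates at the same point of a matching both occur. -/
def CandidatesCollide (m : Matching n)
    (x : Fin (2 * n) × (Bool × Bool × Bool) × (Bool × Bool × Bool)) : Prop :=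
  x.2.1 ≠ x.2.2 ∧ CandidateOccurs m x.1 x.2.1 ∧ CandidateOccurs m x.1 x.2.2

-- A common point of α and another pattern carries two distinct candidates, and this collision
-- determines α.
open Classical in
theorem card_touching_le (m : Matching n) :
    ((patterns m).filter fun α => ∃ β ∈ patterns m, β ≠ α ∧ ∃ p ∈ α.pts, p ∈ β.pts).card ≤
      (Finset.univ.filter (CandidatesCollide m)).card := by
  have h : ((patterns m).filter fun α => ∃ β ∈ patterns m, β ≠ α ∧ ∃ p ∈ α.pts, p ∈ β.pts) ⊆
      (Finset.univ.filter (CandidatesCollide m)).image fun x => candidate m x.1 x.2.1 := by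
    intro α hα
    obtain ⟨hα, β, hβ, hne, p, hpα, hpβ⟩ := Finset.mem_filter.1 hα
    obtain ⟨c, rfl, hc⟩ := exists_candidate hα hpα
    obtain ⟨c', rfl, hc'⟩ := exists_candidate hβ hpβ
    refine Finset.mem_image.2 ⟨(p, c, c'), Finset.mem_filter.2 ⟨Finset.mem_univ _, ?_⟩, rfl⟩
    exact ⟨fun h => hne (congrArg (candidate m p) h.symm), hc, hc'⟩
  exact le_trans (Finset.card_le_card h) Finset.card_image_le

open Classical in
/-- Patterns of a random matching rarely share a point. -/
theorem mean_card_touching_le (hn : 5 ≤ n) :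
    mean (fun m : Matching n => (((patterns m).filter fun α =>
      ∃ β ∈ patterns m, β ≠ α ∧ ∃ p ∈ α.pts, p ∈ β.pts).card : ℝ)) ≤ 256 / n := by
  have hn' : (5 : ℝ) ≤ n := by exact_mod_cast hn
  have h1 : mean (fun m : Matching n => (((patterns m).filter fun α =>
      ∃ β ∈ patterns m, β ≠ α ∧ ∃ p ∈ α.pts, p ∈ β.pts).card : ℝ)) ≤
      mean fun m => ((Finset.univ.filter (CandidatesCollide m)).card : ℝ) :=
    mean_mono fun m => Nat.cast_le.2 (card_touching_le m)
  -- There are 2n · 64 triples, each of probability at most 2/n², whence the constant 256.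
  have h2 : ∑ x, prob (fun m : Matching n => CandidatesCollide m x) ≤
      ∑ _x : Fin (2 * n) × (Bool × Bool × Bool) × (Bool × Bool × Bool), 2 / (n : ℝ) ^ 2 := by
    refine Finset.sum_le_sum fun x _ => ?_
    by_cases hx : x.2.1 = x.2.2
    · rw [prob_eq_zero fun m hm => hm.1 hx]
      positivity
    · exact (prob_mono fun m hm => hm.2).trans (prob_two_candidateOccurs_le hn x.1 hx)
  rw [mean_card_filter] at h1
  refine h1.trans (h2.trans_eq ?_)
  rw [Finset.sum_const, Finset.card_univ, nsmul_eq_mul]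
  simp only [Fintype.card_prod, Fintype.card_fin, Fintype.card_bool]
  push_cast
  field_simp
  norm_num

end Matching

/-! ### Forcing a pattern, and its influence on the other patterns -/

namespace Matching

variable {n : ℕ}

namespace Pattern

/-- Modify a matching so that it contains the pattern. -/
def force (α : Pattern n) (m : Matching n) : Matching n := join α.c α.d (join α.a α.b m)

/-- The inverse of the probability of a pattern. -/
noncomputable def weight (α : Pattern n) : ℝ :=
  open Classical in if α.IsDouble then (2 * n - 1) * (2 * n - 3) else 2 * n - 1

theorem force_of_not_isDouble {α : Pattern n} (hn : 2 ≤ n) (hα : α.Valid) (h : ¬ α.IsDouble)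
    (m : Matching n) : α.force m = join α.a α.b m := by
  obtain ⟨h1, h2⟩ := c_eq_d_eq h
  rw [force, h1, h2, join_of_apply_eq (join_apply_left (a_ne_b hn hα) m)]

theorem occurs_iff_of_not_isDouble {α : Pattern n} (h : ¬ α.IsDouble) (m : Matching n) :
    α.Occurs m ↔ m α.a = α.b := by
  obtain ⟨h1, h2⟩ := c_eq_d_eq h
  rw [Occurs, h1, h2, and_self_iff]

theorem card_erase (a : Fin (2 * n)) :
    ((Finset.univ.erase a).card : ℝ) = 2 * n - 1 := by
  have := a.isLt
  rw [Finset.card_erase_of_mem (Finset.mem_univ a), Finset.card_univ, Fintype.card_fin,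
    Nat.cast_sub (by omega)]
  push_cast
  ring

theorem card_erase_erase_erase {a b c : Fin (2 * n)} (hn : 2 ≤ n) (hab : a ≠ b) (hac : a ≠ c)
    (hbc : b ≠ c) :
    ((((Finset.univ.erase a).erase b).erase c).card : ℝ) = 2 * n - 3 := by
  rw [Finset.card_erase_of_mem (by simp [hac.symm, hbc.symm]),
    Finset.card_erase_of_mem (by simp [hab.symm]),
    Finset.card_erase_of_mem (Finset.mem_univ a), Finset.card_univ, Fintype.card_fin,
    Nat.sub_sub, Nat.sub_sub, Nat.cast_sub (by omega)]
  push_cast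
  ring

/-- The forced matching has the law of a uniform matching conditioned on the pattern: each switching
contributes its number of possible former partners, 2n-1 for the first and 2n-3 for the second. -/
theorem mean_force {α : Pattern n} (hn : 2 ≤ n) (hα : α.Valid) (f : Matching n → ℝ) :
    mean (fun m => f (α.force m)) = α.weight * mean fun m => ind (α.Occurs m) * f m := by
  have hab := a_ne_b hn hα
  by_cases h : α.IsDouble
  · obtain ⟨hcd, hac, had, hbc, hbd⟩ := distinct_of_isDouble hα h
    have h1 := mean_join hab fun m _ => f (join α.c α.d m)
    have h2 := mean_join_of_apply_eq hcd hac had hbc hbd fun m _ => f m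
    rw [Finset.sum_const, nsmul_eq_mul] at h1 h2
    rw [card_erase] at h1
    rw [card_erase_erase_erase hn hab hac hbc] at h2
    rw [weight, if_pos h, mul_assoc]
    exact h1.trans (congrArg _ h2)
  · have h1 := mean_join hab fun m _ => f m
    rw [Finset.sum_const, nsmul_eq_mul, card_erase] at h1
    rw [weight, if_neg h]
    refine (mean_congr fun m => ?_).trans (h1.trans (congrArg _ (mean_congr fun m => ?_)))
    · rw [force_of_not_isDouble hn hα h]
    · rw [ind_congr (occurs_iff_of_not_isDouble h m)]

theorem weight_mul_prob {α : Pattern n} (hn : 2 ≤ n) (hα : α.Valid) :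
    α.weight * prob α.Occurs = 1 := by
  have h := mean_force hn hα fun _ => 1
  rw [mean_const] at h
  rw [h]
  simp [prob]

theorem prob_mul_mean_force {α : Pattern n} (hn : 2 ≤ n) (hα : α.Valid) (f : Matching n → ℝ) :
    prob α.Occurs * mean (fun m => f (α.force m)) = mean fun m => ind (α.Occurs m) * f m := by
  rw [mean_force hn hα, ← mul_assoc, mul_comm (prob _), weight_mul_prob hn hα, one_mul]

theorem le_weight {α : Pattern n} (hn : 2 ≤ n) : 2 * (n : ℝ) - 3 ≤ α.weight := by
  have hn' : (2 : ℝ) ≤ n := by exact_mod_cast hn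
  unfold weight
  split_ifs
  · nlinarith
  · linarith

/-- The former partner of `a` is spread uniformly over 2n-1 points, independently of the forced
matching. The weaker factor 2n-3 is stated to match the bound for `c`, where that is the number of
available points. -/
theorem mean_force_apply_a_le {α : Pattern n} (hn : 2 ≤ n) (hα : α.Valid)
    (g : Matching n → Fin (2 * n) → ℝ) (hg : ∀ m u, 0 ≤ g m u) :
    (2 * n - 3) * mean (fun m => g (α.force m) (m α.a)) ≤
      α.weight * ∑ u, mean fun m => ind (α.Occurs m) * g m u := by
  have hn' : (2 : ℝ) ≤ n := by exact_mod_cast hn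
  have hab := a_ne_b hn hα
  have hnn : ∀ u, 0 ≤ mean fun m => ind (α.Occurs m) * g m u := fun u =>
    mean_nonneg fun m => mul_nonneg (ind_nonneg _) (hg m u)
  by_cases h : α.IsDouble
  · obtain ⟨hcd, hac, had, hbc, hbd⟩ := distinct_of_isDouble hα h
    have h1 := mean_join hab fun m u => g (join α.c α.d m) u
    have h2 : ∀ u, mean (fun m => ind (m α.a = α.b) * g (join α.c α.d m) u) =
        (2 * n - 3) * mean fun m => ind (α.Occurs m) * g m u := by
      intro u
      have h2 := mean_join_of_apply_eq hcd hac had hbc hbd fun m _ => g m u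
      rw [Finset.sum_const, nsmul_eq_mul, card_erase_erase_erase hn hab hac hbc] at h2
      exact h2
    simp only [h2] at h1
    rw [weight, if_pos h, mul_comm (2 * (n : ℝ) - 1), mul_assoc]
    refine mul_le_mul_of_nonneg_left ?_ (by linarith)
    refine h1.trans_le ?_
    rw [← Finset.mul_sum]
    refine mul_le_mul (by linarith) ?_ (Finset.sum_nonneg fun u _ => hnn u) (by linarith)
    exact Finset.sum_le_univ_sum_of_nonneg hnn
  · have h1 := mean_join hab g
    refine mul_le_mul (le_weight hn) ?_ (mean_nonneg fun m => hg _ _)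
      ((by linarith : (0 : ℝ) ≤ 2 * n - 3).trans (le_weight hn))
    calc mean (fun m => g (α.force m) (m α.a)) = mean fun m => g (join α.a α.b m) (m α.a) :=
          mean_congr fun m => by rw [force_of_not_isDouble hn hα h]
      _ = ∑ u ∈ Finset.univ.erase α.a, mean fun m => ind (m α.a = α.b) * g m u := h1
      _ = ∑ u ∈ Finset.univ.erase α.a, mean fun m => ind (α.Occurs m) * g m u :=
          Finset.sum_congr rfl fun u _ => mean_congr fun m => by
            rw [ind_congr (occurs_iff_of_not_isDouble h m)]
      _ ≤ _ := Finset.sum_le_univ_sum_of_nonneg hnn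

theorem mean_force_apply_c_le {α : Pattern n} (hn : 2 ≤ n) (hα : α.Valid) (h : α.IsDouble)
    (g : Matching n → Fin (2 * n) → ℝ) (hg : ∀ m u, 0 ≤ g m u) :
    (2 * n - 3) * mean (fun m => g (α.force m) (join α.a α.b m α.c)) ≤
      α.weight * ∑ u, mean fun m => ind (α.Occurs m) * g m u := by
  have hn' : (2 : ℝ) ≤ n := by exact_mod_cast hn
  have hab := a_ne_b hn hα
  have hnn : ∀ u, 0 ≤ mean fun m => ind (α.Occurs m) * g m u := fun u =>
    mean_nonneg fun m => mul_nonneg (ind_nonneg _) (hg m u)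
  obtain ⟨hcd, hac, had, hbc, hbd⟩ := distinct_of_isDouble hα h
  have h1 := mean_join hab fun m _ => g (join α.c α.d m) (m α.c)
  have h2 := mean_join_of_apply_eq hcd hac had hbc hbd g
  rw [Finset.sum_const, nsmul_eq_mul, card_erase] at h1
  rw [weight, if_pos h, mul_comm (2 * (n : ℝ) - 1), mul_assoc]
  refine mul_le_mul_of_nonneg_left ?_ (by linarith)
  refine h1.trans_le ?_
  refine mul_le_mul_of_nonneg_left ?_ (by linarith)
  exact h2.trans_le (Finset.sum_le_univ_sum_of_nonneg hnn)

theorem Occurs.conj_swap {β : Pattern n} {m : Matching n} (h : β.Occurs m) {x y : Fin (2 * n)}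
    (hx : x ∉ β.pts) (hy : y ∉ β.pts) : β.Occurs (conj (Equiv.swap x y) m) := by
  have key : ∀ p ∈ β.pts, conj (Equiv.swap x y) m p = m p := fun p hp =>
    conj_swap_apply_of_notMem (fun _ => h.apply_mem) hx hy hp
  exact ⟨(key _ (by simp [pts])).trans h.1, (key _ (by simp [pts])).trans h.2⟩

/-- The two switchings exchange labels only within these four points, and each is undone by the same
transposition; a pattern avoiding them is unaffected in both directions. -/
theorem occurs_force_iff {α β : Pattern n} {m : Matching n} (hb : α.b ∉ β.pts) (hd : α.d ∉ β.pts)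
    (ha' : m α.a ∉ β.pts) (hc' : join α.a α.b m α.c ∉ β.pts) :
    β.Occurs (α.force m) ↔ β.Occurs m := by
  constructor
  · intro h
    have h1 := h.conj_swap hd hc'
    rw [force, conj_swap_join] at h1
    have h2 := h1.conj_swap hb ha'
    rwa [conj_swap_join] at h2
  · intro h
    exact (h.conj_swap hb ha').conj_swap hd hc'

theorem occurs_force {α : Pattern n} (hn : 2 ≤ n) (hα : α.Valid) (m : Matching n) :
    α.Occurs (α.force m) := by
  have hab := a_ne_b hn hα
  by_cases h : α.IsDouble
  · obtain ⟨hcd, hac, had, hbc, hbd⟩ := distinct_of_isDouble hα h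
    refine ⟨?_, join_apply_left hcd _⟩
    have h1 := join_apply_left hab m
    have h2 : join α.a α.b m α.c ≠ α.a := fun h' =>
      hbc (h1.symm.trans ((apply_eq_comm _).1 h'))
    have h3 : join α.a α.b m α.c ≠ α.b := fun h' =>
      hac ((join α.a α.b m).injective (h1.trans h'.symm))
    rw [force, join, conj_apply_eq_iff, h1]
    · exact Equiv.swap_apply_of_ne_of_ne had h2.symm
    · exact Equiv.swap_apply_of_ne_of_ne hbd h3.symm
  · rw [occurs_iff_of_not_isDouble h, force_of_not_isDouble hn hα h]
    exact join_apply_left hab m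

/-- The matching contains a pattern sharing a point with `α`. -/
def Touched (α : Pattern n) (m : Matching n) : Prop :=
  ∃ β ∈ patterns m, ∃ p ∈ α.pts, p ∈ β.pts

/-- The matching contains a pattern other than `α` sharing a point with `α`. -/
def TouchedByOther (α : Pattern n) (m : Matching n) : Prop :=
  ∃ β ∈ patterns m, β ≠ α ∧ ∃ p ∈ α.pts, p ∈ β.pts

/-- The matching contains a pattern other than `α` using the point `u`. -/
def UsedByOther (α : Pattern n) (m : Matching n) (u : Fin (2 * n)) : Prop :=
  ∃ β ∈ patterns m, β ≠ α ∧ u ∈ β.pts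

/-- Forcing the pattern `α` may have an influence on other patterns. -/
def Interferes (α : Pattern n) (m : Matching n) : Prop :=
  (α.Touched m ∨ α.TouchedByOther (α.force m)) ∨
    (α.UsedByOther (α.force m) (m α.a) ∨
      (α.IsDouble ∧ α.UsedByOther (α.force m) (join α.a α.b m α.c)))

theorem notMem_patterns_of_not_interferes {α : Pattern n} {m : Matching n}
    (h : ¬ α.Interferes m) : α ∉ patterns m := fun hα =>
  h (Or.inl (Or.inl ⟨α, hα, α.a, α.a_mem_pts, α.a_mem_pts⟩))

/-- A new pattern other than α would have to use a point whose label moved. An old pattern disjoint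
from α also avoids the former partners, because a pattern containing `m a` contains `a`; it
therefore survives. -/
theorem patterns_force {α : Pattern n} (hn : 2 ≤ n) (hα : α.Valid) {m : Matching n}
    (h : ¬ α.Interferes m) : patterns (α.force m) = insert α (patterns m) := by
  simp only [Interferes, Touched, TouchedByOther, UsedByOther, not_or, not_and, not_exists] at h
  obtain ⟨⟨h1, h2⟩, h3, h4⟩ := h
  have ha : α.a ∈ α.pts := by simp [pts]
  have hb : α.b ∈ α.pts := by simp [pts]
  have hc : α.c ∈ α.pts := by simp [pts]
  have hd : α.d ∈ α.pts := by simp [pts]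
  ext β
  rw [Finset.mem_insert]
  constructor
  · intro hβ
    by_cases hβα : β = α
    · exact Or.inl hβα
    right
    have hc' : join α.a α.b m α.c ∉ β.pts := by
      by_cases hdb : α.IsDouble
      · exact h4 hdb β hβ hβα
      -- With a single chord the second switching is trivial: the point in question is `b`, already
      -- excluded as a point of α.
      · rw [(c_eq_d_eq hdb).1, join_apply_left (a_ne_b hn hα)]
        exact h2 β hβ hβα _ hb
    rw [mem_patterns] at hβ ⊢
    refine ⟨hβ.1, (occurs_force_iff ?_ ?_ ?_ hc').1 hβ.2⟩
    · exact h2 β (mem_patterns.2 hβ) hβα _ hb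
    · exact h2 β (mem_patterns.2 hβ) hβα _ hd
    · exact h3 β (mem_patterns.2 hβ) hβα
  · rintro (rfl | hβ)
    · exact mem_patterns.2 ⟨hα, occurs_force hn hα m⟩
    · have h5 := h1 β hβ
      rw [mem_patterns] at hβ ⊢
      have ha' : m α.a ∉ β.pts := fun h => by
        have := hβ.2.apply_mem h
        rw [apply_apply] at this
        exact h5 _ ha this
      have h6 : β.Occurs (join α.a α.b m) := hβ.2.conj_swap (h5 _ hb) ha'
      have hc' : join α.a α.b m α.c ∉ β.pts := fun h => by
        have := h6.apply_mem h
        rw [apply_apply] at this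
        exact h5 _ hc this
      exact ⟨hβ.1, h6.conj_swap (h5 _ hd) hc'⟩

/-- New patterns pass through one of four points, with at most eight through each; the bound 48
leaves room. -/
theorem card_patterns_force_le {α : Pattern n} (m : Matching n) :
    (patterns (α.force m)).card ≤ (patterns m).card + 48 := by
  classical
  set T : Finset (Fin (2 * n)) := {α.b, α.d, m α.a, join α.a α.b m α.c} with hT
  have hTc : T.card ≤ 4 := Finset.card_le_four
  have h : patterns (α.force m) ⊆ patterns m ∪
      T.biUnion fun p => (patterns (α.force m)).filter fun β => p ∈ β.pts := by
    intro β hβ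
    by_cases h : ∃ p ∈ T, p ∈ β.pts
    · obtain ⟨p, hp, hpβ⟩ := h
      exact Finset.mem_union_right _
        (Finset.mem_biUnion.2 ⟨p, hp, Finset.mem_filter.2 ⟨hβ, hpβ⟩⟩)
    · simp only [not_exists, not_and] at h
      refine Finset.mem_union_left _ ?_
      rw [mem_patterns] at hβ ⊢
      exact ⟨hβ.1, (occurs_force_iff (h _ (by simp [hT])) (h _ (by simp [hT]))
        (h _ (by simp [hT])) (h _ (by simp [hT]))).1 hβ.2⟩
  have h1 := Finset.card_biUnion_le_card_mul T
    (fun p => (patterns (α.force m)).filter fun β => p ∈ β.pts) 8 fun p _ => by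
      convert card_patterns_filter_mem_le (α.force m) p
  have h2 := (Finset.card_le_card h).trans (Finset.card_union_le _ _)
  omega

end Pattern

theorem card_patterns_eq_sum (m : Matching n) :
    ((patterns m).card : ℝ) = ∑ α ∈ patternIndices n, ind (α.Occurs m) := by
  classical
  rw [← card_filter_eq_sum_ind]
  congr 2

theorem sum_prob_occurs_le (hn : 5 ≤ n) :
    ∑ α ∈ patternIndices n, prob α.Occurs ≤ 32 := by
  refine le_trans (le_of_eq ?_) (mean_card_patterns_le hn)
  simp only [card_patterns_eq_sum]
  rw [mean_sum]
  rfl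

/-- Size-biasing: the second moment is the sum over α of P(α) times the mean count after forcing α.
That mean is at most 32 + 48 = 80, and the probabilities sum to at most 32. -/
theorem mean_card_patterns_sq_le (hn : 5 ≤ n) :
    mean (fun m : Matching n => ((patterns m).card : ℝ) * (patterns m).card) ≤ 2560 := by
  have h1 : mean (fun m : Matching n => ((patterns m).card : ℝ) * (patterns m).card) =
      ∑ α ∈ patternIndices n,
        prob α.Occurs * mean fun m => ((patterns (α.force m)).card : ℝ) := by
    rw [← Finset.sum_congr rfl fun α hα => (Pattern.prob_mul_mean_force (by omega)
      (mem_patternIndices.1 hα) fun m => ((patterns m).card : ℝ)).symm, ← mean_sum]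
    refine mean_congr fun m => ?_
    rw [← Finset.sum_mul, card_patterns_eq_sum]
  rw [h1]
  calc ∑ α ∈ patternIndices n, prob α.Occurs * mean (fun m => ((patterns (α.force m)).card : ℝ))
      ≤ ∑ α ∈ patternIndices n, prob α.Occurs * 80 := by
        refine Finset.sum_le_sum fun α _ => mul_le_mul_of_nonneg_left ?_ (prob_nonneg _)
        calc mean (fun m => ((patterns (α.force m)).card : ℝ))
            ≤ mean (fun m : Matching n => ((patterns m).card : ℝ) + 48) :=
              mean_mono fun m => by exact_mod_cast Pattern.card_patterns_force_le m
          _ ≤ 80 := by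
              rw [mean_add, mean_const]
              linarith [mean_card_patterns_le hn]
    _ ≤ 2560 := by
        rw [← Finset.sum_mul]
        linarith [sum_prob_occurs_le hn]

theorem prob_touched_le (hn : 5 ≤ n) (α : Pattern n) : prob α.Touched ≤ 64 / n := by
  classical
  calc prob α.Touched
      ≤ prob (fun m => ∃ p ∈ α.pts, 1 ≤ ((patterns m).filter fun β => p ∈ β.pts).card) := by
        refine prob_mono ?_
        rintro m ⟨β, hβ, p, hp, hpβ⟩
        exact ⟨p, hp, Finset.card_pos.2 ⟨β, Finset.mem_filter.2 ⟨hβ, hpβ⟩⟩⟩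
    _ ≤ ∑ p ∈ α.pts, 16 / (n : ℝ) := by
        refine (prob_exists_le _ _).trans (Finset.sum_le_sum fun p _ => ?_)
        refine le_trans (mean_mono fun m => ?_) (mean_card_patterns_mem_le hn p)
        by_cases h : 1 ≤ ((patterns m).filter fun β => p ∈ β.pts).card
        · rw [ind_of h]
          have h' := (Nat.cast_le (α := ℝ)).2 h
          rw [Nat.cast_one] at h'
          convert h'
        · rw [ind_of_not h]
          positivity
    _ ≤ 64 / n := by
        rw [Finset.sum_const, nsmul_eq_mul, mul_div_assoc']
        have : (α.pts.card : ℝ) ≤ 4 := by exact_mod_cast α.card_pts_le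
        gcongr
        linarith

theorem sum_ind_usedByOther_le (α : Pattern n) (m : Matching n) :
    ∑ u, ind (α.UsedByOther m u) ≤ 4 * (patterns m).card := by
  classical
  calc ∑ u, ind (α.UsedByOther m u) ≤ ∑ u, ∑ β ∈ patterns m, ind (u ∈ β.pts) := by
        refine Finset.sum_le_sum fun u _ => ?_
        refine le_trans (ind_mono ?_) (ind_exists_le _ _)
        rintro ⟨β, hβ, -, hu⟩
        exact ⟨β, hβ, hu⟩
    _ = ∑ β ∈ patterns m, (β.pts.card : ℝ) := by
        rw [Finset.sum_comm]
        refine Finset.sum_congr rfl fun β _ => ?_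
        rw [← card_filter_eq_sum_ind]
        congr 2
        ext; simp
    _ ≤ ∑ β ∈ patterns m, (4 : ℝ) :=
        Finset.sum_le_sum fun β _ => by exact_mod_cast β.card_pts_le
    _ = 4 * (patterns m).card := by rw [Finset.sum_const, nsmul_eq_mul, mul_comm]

/-- A matching with N patterns has at most 4N points on patterns, so the sum is at most 4 E[N²]. -/
theorem sum_usedByOther_le (hn : 5 ≤ n) :
    ∑ α ∈ patternIndices n, ∑ u, mean (fun m => ind (α.Occurs m) * ind (α.UsedByOther m u)) ≤
      10240 := by
  calc ∑ α ∈ patternIndices n, ∑ u, mean (fun m => ind (α.Occurs m) * ind (α.UsedByOther m u))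
      = mean (fun m => ∑ α ∈ patternIndices n,
          ind (α.Occurs m) * ∑ u, ind (α.UsedByOther m u)) := by
        rw [mean_sum]
        refine Finset.sum_congr rfl fun α _ => ?_
        rw [← mean_sum]
        exact mean_congr fun m => (Finset.mul_sum _ _ _).symm
    _ ≤ mean (fun m => 4 * (((patterns m).card : ℝ) * (patterns m).card)) := by
        refine mean_mono fun m => ?_
        calc ∑ α ∈ patternIndices n, ind (α.Occurs m) * ∑ u, ind (α.UsedByOther m u)
            ≤ ∑ α ∈ patternIndices n, ind (α.Occurs m) * (4 * (patterns m).card) :=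
              Finset.sum_le_sum fun α _ =>
                mul_le_mul_of_nonneg_left (sum_ind_usedByOther_le α m) (ind_nonneg _)
          _ = 4 * (((patterns m).card : ℝ) * (patterns m).card) := by
              rw [← Finset.sum_mul, ← card_patterns_eq_sum]
              ring
    _ ≤ 10240 := by
        rw [mean_mul_left]
        linarith [mean_card_patterns_sq_le hn]

/-- Forcing a random pattern rarely has an influence on other patterns. -/
theorem sum_prob_interferes_le (hn : 5 ≤ n) :
    ∑ α ∈ patternIndices n, prob α.Occurs * prob α.Interferes ≤ 22784 / n := by
  classical
  have hn' : (5 : ℝ) ≤ n := by exact_mod_cast hn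
  have hn2 : 2 ≤ n := by omega
  set U : Pattern n → ℝ := fun α =>
    ∑ u, mean (fun m => ind (α.Occurs m) * ind (α.UsedByOther m u)) with hU
  have hU0 : ∀ α, 0 ≤ U α := fun α => Finset.sum_nonneg fun u _ =>
    mean_nonneg fun m => mul_nonneg (ind_nonneg _) (ind_nonneg _)
  -- Multiplying by P(α) cancels the weight, and 2n-3 ≥ n.
  have key : ∀ α : Pattern n, α.Valid → ∀ x : ℝ, (2 * n - 3) * x ≤ α.weight * U α →
      prob α.Occurs * x ≤ U α / n := by
    intro α hα x hx
    have h1 := Pattern.weight_mul_prob hn2 hα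
    have h2 := prob_nonneg α.Occurs
    rw [le_div_iff₀ (by linarith)]
    have h3 : (2 * n - 3) * (prob α.Occurs * x) ≤ U α := by
      calc (2 * n - 3) * (prob α.Occurs * x) = prob α.Occurs * ((2 * n - 3) * x) := by ring
        _ ≤ prob α.Occurs * (α.weight * U α) := mul_le_mul_of_nonneg_left hx h2
        _ = (α.weight * prob α.Occurs) * U α := by ring
        _ = U α := by rw [h1, one_mul]
    by_cases hx0 : 0 ≤ prob α.Occurs * x
    · nlinarith
    · nlinarith [hU0 α]
  have h1 : ∀ α ∈ patternIndices n, prob α.Occurs * prob α.Interferes ≤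
      prob α.Occurs * (64 / n) + mean (fun m => ind (α.Occurs m) * ind (α.TouchedByOther m)) +
        (U α / n + U α / n) := by
    intro α hα
    rw [mem_patternIndices] at hα
    have h2 := prob_nonneg α.Occurs
    have e1 : prob α.Occurs * prob (fun m => α.TouchedByOther (α.force m)) =
        mean (fun m => ind (α.Occurs m) * ind (α.TouchedByOther m)) :=
      Pattern.prob_mul_mean_force hn2 hα fun m => ind (α.TouchedByOther m)
    have e2 : prob α.Occurs * prob (fun m => α.UsedByOther (α.force m) (m α.a)) ≤ U α / n :=
      key α hα _ (Pattern.mean_force_apply_a_le hn2 hα (fun m u => ind (α.UsedByOther m u))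
        fun _ _ => ind_nonneg _)
    have e3 : prob α.Occurs * prob (fun m => α.IsDouble ∧
        α.UsedByOther (α.force m) (join α.a α.b m α.c)) ≤ U α / n := by
      by_cases hd : α.IsDouble
      · simp only [hd, true_and]
        exact key α hα _ (Pattern.mean_force_apply_c_le hn2 hα hd
          (fun m u => ind (α.UsedByOther m u)) fun _ _ => ind_nonneg _)
      · rw [prob_eq_zero (p := fun m => α.IsDouble ∧ _) fun m hm => hd hm.1, mul_zero]
        exact div_nonneg (hU0 α) (by linarith)
    calc prob α.Occurs * prob α.Interferes
        ≤ prob α.Occurs * ((prob α.Touched + prob (fun m => α.TouchedByOther (α.force m))) +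
          (prob (fun m => α.UsedByOther (α.force m) (m α.a)) + prob (fun m => α.IsDouble ∧
            α.UsedByOther (α.force m) (join α.a α.b m α.c)))) := by
          refine mul_le_mul_of_nonneg_left ?_ h2
          refine (prob_or_le _ _).trans (add_le_add (prob_or_le _ _) (prob_or_le _ _))
      _ ≤ _ := by
          rw [mul_add, mul_add, mul_add, e1]
          have := mul_le_mul_of_nonneg_left (prob_touched_le hn α) h2
          linarith
  refine (Finset.sum_le_sum h1).trans ?_
  rw [Finset.sum_add_distrib, Finset.sum_add_distrib, Finset.sum_add_distrib, ← Finset.sum_mul,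
    ← Finset.sum_div]
  have h2 : ∑ α ∈ patternIndices n, mean (fun m => ind (α.Occurs m) * ind (α.TouchedByOther m)) ≤
      256 / n := by
    refine le_trans (le_of_eq ?_) (mean_card_touching_le hn)
    rw [← mean_sum]
    refine mean_congr fun m => ?_
    rw [card_filter_eq_sum_ind, patterns, Finset.sum_filter]
    refine Finset.sum_congr rfl fun α _ => ?_
    by_cases h : α.Occurs m
    · rw [if_pos h, ind_of h, one_mul]
      rfl
    · rw [if_neg h, ind_of_not h, zero_mul]
  have h3 := sum_usedByOther_le hn
  have h4 := sum_prob_occurs_le hn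
  have h5 : (∑ α ∈ patternIndices n, U α) / n ≤ 10240 / n := by gcongr
  have h6 : (∑ α ∈ patternIndices n, prob α.Occurs) * (64 / (n : ℝ)) ≤ 32 * (64 / n) := by gcongr
  -- The terms are, in order: patterns touching α before forcing, patterns touching it afterwards,
  -- and the former partners of `a` and of `c`.
  calc _ ≤ 32 * (64 / (n : ℝ)) + 256 / n + (10240 / n + 10240 / n) := by linarith
    _ = 22784 / n := by ring

end Matching

/-! ### Pattern counts and their approximate recursion -/

namespace Matching

variable {n : ℕ}

/-- The number of patterns of each kind contained in a matching. -/
noncomputable def patternCount (m : Matching n) (t : Fin 3) : ℕ :=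
  ((patterns m).filter fun α => α.1 = t).card

theorem countX_eq (m : Matching n) : m.countX = m.patternCount 0 := by
  refine Finset.card_bij (fun i _ => (0, i, next i)) ?_ ?_ ?_
  · intro i hi
    have hi' := (Finset.mem_filter.1 hi).2
    simp [mem_patterns, Pattern.Valid, Pattern.Occurs, Pattern.a, Pattern.b, Pattern.c, Pattern.d,
      hi']
  · intro i _ j _ h
    simp only [Prod.mk.injEq] at h
    exact h.2.1
  · rintro ⟨t, k, l⟩ h
    simp only [Finset.mem_filter, mem_patterns] at h
    obtain ⟨⟨hv, ho⟩, rfl⟩ := h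
    simp only [Pattern.Valid, true_and, Fin.reduceEq, false_and, or_false] at hv
    subst hv
    refine ⟨k, Finset.mem_filter.2 ⟨Finset.mem_univ _, ?_⟩, rfl⟩
    simpa [Pattern.a, Pattern.b] using ho.1

theorem countY_eq (m : Matching n) : m.countY = m.patternCount 1 := by
  refine Finset.card_bij (fun i _ => (1, i, next (next i))) ?_ ?_ ?_
  · intro i hi
    have hi' := (Finset.mem_filter.1 hi).2
    simp [mem_patterns, Pattern.Valid, Pattern.Occurs, Pattern.a, Pattern.b, Pattern.c, Pattern.d,
      hi']
  · intro i _ j _ h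
    simp only [Prod.mk.injEq] at h
    exact h.2.1
  · rintro ⟨t, k, l⟩ h
    simp only [Finset.mem_filter, mem_patterns] at h
    obtain ⟨⟨hv, ho⟩, rfl⟩ := h
    simp only [Pattern.Valid, true_and, Fin.reduceEq, false_and, or_false, false_or] at hv
    subst hv
    refine ⟨k, Finset.mem_filter.2 ⟨Finset.mem_univ _, ?_⟩, rfl⟩
    simpa [Pattern.a, Pattern.b] using ho.1

theorem pair_eq_pair_iff {ι : Type*} [DecidableEq ι] {a b c d : ι} :
    ({a, b} : Finset ι) = {c, d} ↔ a = c ∧ b = d ∨ a = d ∧ b = c := by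
  rw [← Finset.coe_inj]
  simp only [Finset.coe_insert, Finset.coe_singleton]
  exact Set.pair_eq_pair_iff

/-- Two pairs of neighbours can be joined in two ways; the order of the base points records which
one, so each way has exactly one index. -/
theorem mem_patterns_two {m : Matching n} {k l : Fin (2 * n)} :
    ((2, k, l) : Pattern n) ∈ patterns m ↔ (l ≠ k ∧ l ≠ next k ∧ k ≠ next l) ∧
      if l < k then m k = next l ∧ m (next k) = l else m k = l ∧ m (next k) = next l := by
  rw [mem_patterns]
  by_cases h : l < k <;>
  simp [Pattern.Valid, Pattern.Occurs, Pattern.a, Pattern.b, Pattern.c, Pattern.d, h]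

/-- Sorting the base points forgets how the pairs are joined. Nothing is counted twice, because a
matching cannot join the same two pairs in both ways. -/
theorem countZ_eq (m : Matching n) : m.countZ = m.patternCount 2 := by
  symm
  refine Finset.card_bij (fun α _ => (min α.2.1 α.2.2, max α.2.1 α.2.2)) ?_ ?_ ?_
  · rintro ⟨t, k, l⟩ h
    obtain ⟨h1, h2⟩ := Finset.mem_filter.1 h
    simp only at h2
    subst h2
    obtain ⟨⟨h2, h3, h4⟩, h5⟩ := mem_patterns_two.1 h1
    simp only [Finset.mem_filter, Finset.mem_univ, true_and]
    rcases lt_or_gt_of_ne h2 with hlt | hlt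
    · rw [if_pos hlt] at h5
      rw [min_eq_right hlt.le, max_eq_left hlt.le, pair_eq_pair_iff]
      refine ⟨hlt, h4, h3, Or.inr ?_⟩
      rw [m.apply_eq_comm, m.apply_eq_comm (i := next l)]
      exact ⟨h5.2, h5.1⟩
    · rw [if_neg hlt.not_gt] at h5
      rw [min_eq_left hlt.le, max_eq_right hlt.le, pair_eq_pair_iff]
      exact ⟨hlt, h3, h4, Or.inl h5⟩
  · rintro ⟨t, k, l⟩ h ⟨t', k', l'⟩ h' heq
    obtain ⟨h1, h2⟩ := Finset.mem_filter.1 h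
    obtain ⟨h1', h2'⟩ := Finset.mem_filter.1 h'
    simp only at h2 h2'
    subst h2 h2'
    simp only [Prod.mk.injEq] at heq ⊢
    obtain ⟨⟨h2, -⟩, h5⟩ := mem_patterns_two.1 h1
    obtain ⟨⟨h2', -⟩, h5'⟩ := mem_patterns_two.1 h1'
    rcases lt_or_gt_of_ne h2 with hlt | hlt <;> rcases lt_or_gt_of_ne h2' with hlt' | hlt'
    · rw [min_eq_right hlt.le, max_eq_left hlt.le, min_eq_right hlt'.le, max_eq_left hlt'.le] at heq
      exact ⟨trivial, heq.2, heq.1⟩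
    · rw [min_eq_right hlt.le, max_eq_left hlt.le, min_eq_left hlt'.le, max_eq_right hlt'.le] at heq
      obtain ⟨rfl, rfl⟩ := heq
      rw [if_pos hlt] at h5
      rw [if_neg hlt'.not_gt] at h5'
      have h6 := m.apply_eq_comm.1 h5.1
      exact absurd (m.injective (h6.trans h5'.1.symm)) (next_ne _)
    · rw [min_eq_left hlt.le, max_eq_right hlt.le, min_eq_right hlt'.le, max_eq_left hlt'.le] at heq
      obtain ⟨rfl, rfl⟩ := heq
      rw [if_neg hlt.not_gt] at h5
      rw [if_pos hlt'] at h5'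
      have h6 := m.apply_eq_comm.1 h5.1
      exact absurd (h5'.1.symm.trans h6) (next_ne _)
    · rw [min_eq_left hlt.le, max_eq_right hlt.le, min_eq_left hlt'.le, max_eq_right hlt'.le] at heq
      exact ⟨trivial, heq.1, heq.2⟩
  · rintro ⟨k, l⟩ h
    simp only [Finset.mem_filter, Finset.mem_univ, true_and] at h
    obtain ⟨hlt, h1, h2, h3⟩ := h
    rw [pair_eq_pair_iff] at h3
    rcases h3 with h3 | h3
    · refine ⟨(2, k, l), Finset.mem_filter.2 ⟨mem_patterns_two.2 ⟨⟨hlt.ne', h1, h2⟩, ?_⟩, rfl⟩, ?_⟩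
      · rwa [if_neg hlt.not_gt]
      · simp only [min_eq_left hlt.le, max_eq_right hlt.le]
    · refine ⟨(2, l, k), Finset.mem_filter.2 ⟨mem_patterns_two.2 ⟨⟨hlt.ne, h2, h1⟩, ?_⟩, rfl⟩, ?_⟩
      · rw [if_pos hlt]
        exact ⟨m.apply_eq_comm.1 h3.2, m.apply_eq_comm.1 h3.1⟩
      · simp only [min_eq_right hlt.le, max_eq_left hlt.le]

theorem card_patternIndices_filter_zero :
    ((patternIndices n).filter fun α => α.1 = 0).card = 2 * n := by
  refine Eq.trans (Eq.symm ?_) ((Finset.card_univ).trans (Fintype.card_fin (2 * n)))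
  refine Finset.card_bij (fun i _ => (0, i, next i)) ?_ ?_ ?_
  · intro i _
    simp [mem_patternIndices, Pattern.Valid]
  · intro i _ j _ h
    simp only [Prod.mk.injEq] at h
    exact h.2.1
  · rintro ⟨t, k, l⟩ h
    simp only [Finset.mem_filter, mem_patternIndices] at h
    obtain ⟨hv, rfl⟩ := h
    simp only [Pattern.Valid, true_and, Fin.reduceEq, false_and, or_false] at hv
    subst hv
    exact ⟨k, Finset.mem_univ _, rfl⟩

theorem card_patternIndices_filter_one :
    ((patternIndices n).filter fun α => α.1 = 1).card = 2 * n := by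
  refine Eq.trans (Eq.symm ?_) ((Finset.card_univ).trans (Fintype.card_fin (2 * n)))
  refine Finset.card_bij (fun i _ => (1, i, next (next i))) ?_ ?_ ?_
  · intro i _
    simp [mem_patternIndices, Pattern.Valid]
  · intro i _ j _ h
    simp only [Prod.mk.injEq] at h
    exact h.2.1
  · rintro ⟨t, k, l⟩ h
    simp only [Finset.mem_filter, mem_patternIndices] at h
    obtain ⟨hv, rfl⟩ := h
    simp only [Pattern.Valid, true_and, Fin.reduceEq, false_and, or_false, false_or] at hv
    subst hv
    exact ⟨k, Finset.mem_univ _, rfl⟩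

theorem card_patternIndices_filter_two (hn : 2 ≤ n) :
    (((patternIndices n).filter fun α => α.1 = 2).card : ℝ) = 2 * n * (2 * n - 3) := by
  have h : ((patternIndices n).filter fun α => α.1 = 2).card =
      ((Finset.univ : Finset (Fin (2 * n))).sigma fun k =>
        ((Finset.univ.erase k).erase (next k)).erase (prev k)).card := by
    refine Finset.card_bij (fun α _ => ⟨α.2.1, α.2.2⟩) ?_ ?_ ?_
    · rintro ⟨t, k, l⟩ h
      simp only [Finset.mem_filter, mem_patternIndices] at h
      obtain ⟨hv, rfl⟩ := h
      simp only [Pattern.Valid, true_and, Fin.reduceEq, false_and, false_or] at hv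
      simp only [Finset.mem_sigma, Finset.mem_univ, Finset.mem_erase, true_and, and_true]
      exact ⟨fun h => hv.2.2 (by rw [h, next_prev]), hv.2.1, hv.1⟩
    · rintro ⟨t, k, l⟩ h ⟨t', k', l'⟩ h' heq
      simp only [Finset.mem_filter] at h h'
      simp only [Sigma.mk.injEq, heq_eq_eq] at heq
      rw [h.2, h'.2, heq.1, heq.2]
    · rintro ⟨k, l⟩ h
      simp only [Finset.mem_sigma, Finset.mem_univ, Finset.mem_erase, true_and, and_true] at h
      refine ⟨(2, k, l), ?_, rfl⟩
      simp only [Finset.mem_filter, mem_patternIndices, Pattern.Valid, true_and, Fin.reduceEq,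
        false_and, false_or, and_true]
      exact ⟨h.2.2, h.2.1, fun h' => h.1 (by rw [h', prev_next])⟩
  rw [h, Finset.card_sigma, Nat.cast_sum]
  have h1 : ∀ k : Fin (2 * n),
      (((((Finset.univ.erase k).erase (next k)).erase (prev k)).card : ℕ) : ℝ) = 2 * n - 3 := by
    intro k
    refine Pattern.card_erase_erase_erase hn (next_ne k).symm ?_ ?_
    · rw [ne_eq, eq_comm, prev_eq_iff]
      exact (next_ne k).symm
    · rw [ne_eq, eq_comm, prev_eq_iff]
      exact (next_next_ne hn k).symm
  simp only [h1]
  rw [Finset.sum_const, Finset.card_univ, Fintype.card_fin, nsmul_eq_mul]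
  push_cast
  ring

/-- For pairs of chords the factor 2n-3 in the number of indices cancels the one in the weight, so
all three kinds have the same mean. -/
theorem sum_prob_occurs_filter (hn : 2 ≤ n) (t : Fin 3) :
    ∑ α ∈ (patternIndices n).filter (fun α => α.1 = t), prob α.Occurs = 2 * n / (2 * n - 1) := by
  have hn' : (2 : ℝ) ≤ n := by exact_mod_cast hn
  have h1 : (2 * n - 1 : ℝ) ≠ 0 := by linarith
  have h3 : (2 * n - 3 : ℝ) ≠ 0 := by linarith
  have key : ∀ w : ℝ, w ≠ 0 → (∀ α : Pattern n, α.1 = t → α.weight = w) →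
      ∑ α ∈ (patternIndices n).filter (fun α => α.1 = t), prob α.Occurs =
        ((patternIndices n).filter fun α => α.1 = t).card / w := by
    intro w hw hα
    rw [div_eq_mul_inv, ← nsmul_eq_mul, ← Finset.sum_const]
    refine Finset.sum_congr rfl fun α hmem => ?_
    obtain ⟨h4, h5⟩ := Finset.mem_filter.1 hmem
    have h6 := Pattern.weight_mul_prob hn (mem_patternIndices.1 h4)
    rw [hα α h5] at h6
    exact eq_inv_of_mul_eq_one_right h6
  have ht : t = 0 ∨ t = 1 ∨ t = 2 := by
    clear key; revert t; decide
  rcases ht with rfl | rfl | rfl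
  · rw [key (2 * n - 1) h1, card_patternIndices_filter_zero]
    · push_cast; rfl
    · intro α hα
      rw [Pattern.weight, if_neg]
      rw [Pattern.IsDouble, hα]; decide
  · rw [key (2 * n - 1) h1, card_patternIndices_filter_one]
    · push_cast; rfl
    · intro α hα
      rw [Pattern.weight, if_neg]
      rw [Pattern.IsDouble, hα]; decide
  · rw [key ((2 * n - 1) * (2 * n - 3)) (mul_ne_zero h1 h3), card_patternIndices_filter_two hn]
    · field_simp
    · intro α hα
      rw [Pattern.weight, if_pos (show α.IsDouble from hα)]

theorem patternCount_force {α : Pattern n} (hn : 2 ≤ n) (hα : α.Valid) {m : Matching n}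
    (h : ¬ α.Interferes m) :
    patternCount (α.force m) = patternCount m + Pi.single α.1 1 := by
  funext t
  rw [patternCount, Pattern.patterns_force hn hα h, Finset.filter_insert, Pi.add_apply]
  by_cases ht : α.1 = t
  · subst ht
    rw [if_pos rfl, Finset.card_insert_of_notMem, Pi.single_eq_same, patternCount]
    intro h'
    exact Pattern.notMem_patterns_of_not_interferes h (Finset.mem_filter.1 h').1
  · rw [if_neg ht, Pi.single_eq_of_ne (Ne.symm ht), add_zero, patternCount]

theorem abs_prob_sub_le (p q r : Matching n → Prop) (h : ∀ m, ¬ r m → (p m ↔ q m)) :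
    |prob p - prob q| ≤ prob r := by
  unfold prob
  rw [← mean_sub]
  refine (abs_mean_le _).trans (mean_mono fun m => ?_)
  by_cases hr : r m
  · rw [ind_of hr, abs_le]
    constructor <;> linarith [ind_nonneg (p m), ind_nonneg (q m), ind_le_one (p m),
      ind_le_one (q m)]
  · rw [ind_congr (h m hr), sub_self, abs_zero]
    exact ind_nonneg _

theorem patternCount_eq_sum (m : Matching n) (t : Fin 3) :
    (patternCount m t : ℝ) =
      ∑ α ∈ (patternIndices n).filter (fun α => α.1 = t), ind (α.Occurs m) := by
  classical
  rw [← card_filter_eq_sum_ind, patternCount, patterns, Finset.filter_comm]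

/-- The recursion satisfied up to an error `O(1 / n)` by the law of the numbers of patterns. -/
theorem abs_recursion_le (hn : 5 ≤ n) (t : Fin 3) (v : Fin 3 → ℕ) :
    |(v t + 1) * prob (fun m : Matching n => patternCount m = v + Pi.single t 1) -
      prob (fun m : Matching n => patternCount m = v)| ≤ 22785 / n := by
  classical
  have hn' : (5 : ℝ) ≤ n := by exact_mod_cast hn
  have hn2 : 2 ≤ n := by omega
  set w : Fin 3 → ℕ := v + Pi.single t 1 with hw
  set s := (patternIndices n).filter fun α => α.1 = t with hs
  -- On the event that the counts equal `w`, exactly `w t = v t + 1` patterns of kind `t` occur, so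
  -- the sum of their indicators is this constant.
  have h1 : (v t + 1) * prob (fun m : Matching n => patternCount m = w) =
      ∑ α ∈ s, prob α.Occurs * prob fun m => patternCount (α.force m) = w := by
    have h2 : ∀ α ∈ s, prob α.Occurs * prob (fun m => patternCount (α.force m) = w) =
        mean fun m => ind (α.Occurs m) * ind (patternCount m = w) := fun α hα =>
      Pattern.prob_mul_mean_force hn2 (mem_patternIndices.1 (Finset.mem_filter.1 hα).1)
        fun m => ind (patternCount m = w)
    rw [Finset.sum_congr rfl h2, ← mean_sum]
    unfold prob
    rw [← mean_mul_left]
    refine mean_congr fun m => ?_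
    rw [← Finset.sum_mul, ← patternCount_eq_sum]
    by_cases h : patternCount m = w
    · rw [ind_of h, h, hw]
      simp
    · rw [ind_of_not h, mul_zero, mul_zero]
  set P := prob (fun m : Matching n => patternCount m = v) with hP
  have hP0 : 0 ≤ P := prob_nonneg _
  have hP1 : P ≤ 1 := prob_le_one _
  have h2 : ∀ α ∈ s, |prob α.Occurs * prob (fun m => patternCount (α.force m) = w) -
      prob α.Occurs * P| ≤ prob α.Occurs * prob α.Interferes := by
    intro α hα
    rw [← mul_sub, abs_mul, abs_of_nonneg (prob_nonneg _)]
    refine mul_le_mul_of_nonneg_left (abs_prob_sub_le _ _ _ fun m hm => ?_) (prob_nonneg _)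
    obtain ⟨hα, ht⟩ := Finset.mem_filter.1 hα
    rw [patternCount_force hn2 (mem_patternIndices.1 hα) hm, ht, hw]
    exact add_left_inj _
  have h3 : |∑ α ∈ s, prob α.Occurs * prob (fun m => patternCount (α.force m) = w) -
      (∑ α ∈ s, prob α.Occurs) * P| ≤ 22784 / n := by
    rw [Finset.sum_mul, ← Finset.sum_sub_distrib]
    refine (Finset.abs_sum_le_sum_abs _ _).trans ((Finset.sum_le_sum h2).trans ?_)
    refine le_trans ?_ (sum_prob_interferes_le hn)
    exact Finset.sum_le_sum_of_subset_of_nonneg (Finset.filter_subset _ _) fun α _ _ =>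
      mul_nonneg (prob_nonneg _) (prob_nonneg _)
  rw [sum_prob_occurs_filter hn2] at h3
  -- Replacing the mean 2n/(2n-1) by 1 adds the last 1/n to the error.
  have h4 : |2 * (n : ℝ) / (2 * n - 1) * P - P| ≤ 1 / n := by
    have h5 : 2 * (n : ℝ) / (2 * n - 1) * P - P = P / (2 * n - 1) := by
      have : (2 * n - 1 : ℝ) ≠ 0 := by linarith
      field_simp
      ring
    rw [h5, abs_of_nonneg (div_nonneg hP0 (by linarith))]
    exact div_le_div₀ zero_le_one hP1 (by linarith) (by linarith)
  rw [h1]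
  calc _ ≤ _ := abs_sub_le _ (2 * (n : ℝ) / (2 * n - 1) * P) _
    _ ≤ 22784 / n + 1 / n := add_le_add h3 h4
    _ = 22785 / n := by ring

theorem sum_patternCount (m : Matching n) : ∑ t, patternCount m t = (patterns m).card :=
  (Finset.card_eq_sum_card_fiberwise (f := fun α : Pattern n => α.1) (t := Finset.univ)
    fun _ _ => Finset.mem_coe.2 (Finset.mem_univ _)).symm

end Matching

/-! ### From recursion and point masses to convergence in law -/

/-- Poisson convergence from an approximate recursion and tightness. -/
theorem tendsto_of_recursion {p : ℕ → (Fin 3 → ℕ) → ℝ} {C : ℝ} (h0 : ∀ n w, 0 ≤ p n w)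
    (h1 : ∀ n w, p n w ≤ 1)
    (hrec : ∀ t v, Tendsto (fun n => (v t + 1) * p n (v + Pi.single t 1) - p n v) atTop (𝓝 0))
    (htight : ∀ K : ℕ, 0 < K → ∀ᶠ n in atTop,
      |∑ w ∈ Fintype.piFinset (fun _ => Finset.range K), p n w - 1| ≤ C / K) (w : Fin 3 → ℕ) :
    Tendsto (fun n => p n w) atTop (𝓝 (Real.exp (-3) * ∏ t, ((w t).factorial : ℝ)⁻¹)) := by
  -- By induction on the sum of the coordinates, the recursion expresses every mass through the mass
  -- at 0 up to o(1).
  have hA : ∀ (k : ℕ) (w : Fin 3 → ℕ), ∑ t, w t = k →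
      Tendsto (fun n => p n w - p n 0 * ∏ t, ((w t).factorial : ℝ)⁻¹) atTop (𝓝 0) := by
    intro k
    induction k with
    | zero =>
      intro w hw
      have : w = 0 := by
        funext t
        exact (Finset.sum_eq_zero_iff.1 hw) t (Finset.mem_univ t)
      subst this
      simp
    | succ k ih =>
      intro w hw
      obtain ⟨t, ht⟩ : ∃ t, w t ≠ 0 := by
        by_contra! h
        simp [h] at hw
      set v : Fin 3 → ℕ := w - Pi.single t 1 with hv
      have hwv : w = v + Pi.single t 1 := by
        rw [hv, tsub_add_cancel_of_le]
        intro s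
        by_cases hs : s = t
        · subst hs
          rw [Pi.single_eq_same]
          exact Nat.one_le_iff_ne_zero.2 ht
        · rw [Pi.single_eq_of_ne hs]
          exact Nat.zero_le _
      have hsum : ∑ t, v t = k := by
        rw [hwv] at hw
        simp only [Pi.add_apply, Finset.sum_add_distrib, Finset.sum_pi_single', Finset.mem_univ,
          if_true] at hw
        omega
      have hne : ((v t : ℝ) + 1) ≠ 0 := by positivity
      have hprod : ∏ s, ((w s).factorial : ℝ)⁻¹ =
          ((v t : ℝ) + 1)⁻¹ * ∏ s, ((v s).factorial : ℝ)⁻¹ := by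
        rw [← Finset.mul_prod_erase _ _ (Finset.mem_univ t),
          ← Finset.mul_prod_erase _ (fun s => ((v s).factorial : ℝ)⁻¹) (Finset.mem_univ t),
          ← mul_assoc]
        congr 1
        · rw [hwv, Pi.add_apply, Pi.single_eq_same, Nat.factorial_succ]
          push_cast
          rw [mul_inv]
        · refine Finset.prod_congr rfl fun s hs => ?_
          rw [hwv, Pi.add_apply, Pi.single_eq_of_ne (Finset.ne_of_mem_erase hs), add_zero]
      have h2 := ((hrec t v).add (ih v hsum)).const_mul ((v t : ℝ) + 1)⁻¹
      rw [add_zero, mul_zero] at h2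
      refine h2.congr fun n => ?_
      rw [hprod, ← hwv]
      field_simp
      ring
  set S : ℕ → ℝ := fun K => ∑ w ∈ Fintype.piFinset (fun _ : Fin 3 => Finset.range K),
    ∏ t, ((w t).factorial : ℝ)⁻¹ with hS
  -- The sum over a box factors into the cube of a partial sum of the exponential series.
  have hSlim : Tendsto S atTop (𝓝 (Real.exp 3)) := by
    have h2 : Tendsto (fun K : ℕ => ∑ k ∈ Finset.range K, ((k.factorial : ℝ))⁻¹) atTop
        (𝓝 (Real.exp 1)) := by
      have := (NormedSpace.expSeries_div_hasSum_exp (𝔸 := ℝ) (1 : ℝ)).tendsto_sum_nat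
      simpa [Real.exp_eq_exp_ℝ] using this
    have h3 := h2.pow 3
    rw [← Real.exp_nat_mul] at h3
    norm_num at h3
    refine h3.congr fun K => ?_
    simp only [hS]
    rw [← Finset.prod_univ_sum (fun _ : Fin 3 => Finset.range K)
      (fun _ k => ((k.factorial : ℝ))⁻¹), Finset.prod_const]
    simp
  have hB : ∀ K, Tendsto (fun n =>
      ∑ w ∈ Fintype.piFinset (fun _ : Fin 3 => Finset.range K), p n w - p n 0 * S K)
      atTop (𝓝 0) := by
    intro K
    have := tendsto_finsetSum (Fintype.piFinset (fun _ : Fin 3 => Finset.range K))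
      fun w _ => hA _ w rfl
    rw [Finset.sum_const_zero] at this
    refine this.congr fun n => ?_
    rw [Finset.sum_sub_distrib, ← Finset.mul_sum]
  -- Normalisation identifies the mass at 0: a box carries p n 0 · S K + o(1), and also 1 up to C/K.
  -- First K is chosen large, then n.
  have hq : Tendsto (fun n => p n 0 * Real.exp 3) atTop (𝓝 1) := by
    rw [Metric.tendsto_atTop']
    intro ε hε
    have hC : Tendsto (fun K : ℕ => C / (K : ℝ)) atTop (𝓝 0) :=
      tendsto_const_div_atTop_nhds_zero_nat C
    obtain ⟨K, hK1, hK2, hK3⟩ := ((hC.eventually (gt_mem_nhds (show 0 < ε / 3 by positivity))).and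
      ((hSlim.eventually (Metric.ball_mem_nhds _ (show 0 < ε / 3 by positivity))).and
        (eventually_gt_atTop 0))).exists
    have h4 := (hB K).eventually (Metric.ball_mem_nhds _ (show 0 < ε / 3 by positivity))
    obtain ⟨N, hN⟩ := eventually_atTop.1 (h4.and (htight K hK3))
    refine ⟨N, fun n hn => ?_⟩
    obtain ⟨h5, h6⟩ := hN n hn.le
    rw [Real.dist_eq] at h5 hK2
    rw [Real.dist_eq]
    rw [sub_zero] at h5
    set A := ∑ w ∈ Fintype.piFinset (fun _ : Fin 3 => Finset.range K), p n w
    have e1 : |p n 0 * (S K - Real.exp 3)| < ε / 3 := by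
      rw [abs_mul, abs_of_nonneg (h0 n 0)]
      exact (mul_le_of_le_one_left (abs_nonneg _) (h1 n 0)).trans_lt hK2
    have e2 : p n 0 * Real.exp 3 - 1 =
        (A - 1) - (A - p n 0 * S K) - p n 0 * (S K - Real.exp 3) := by ring
    rw [e2]
    rw [abs_lt] at h5 e1
    rw [abs_le] at h6
    rw [abs_lt]
    constructor <;> linarith
  have hq' : Tendsto (fun n => p n 0) atTop (𝓝 (Real.exp (-3))) := by
    have := hq.mul_const (Real.exp (-3))
    rw [one_mul] at this
    refine this.congr fun n => ?_
    rw [mul_assoc, ← Real.exp_add]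
    simp
  have := (hA _ w rfl).add (hq'.mul_const (∏ t, ((w t).factorial : ℝ)⁻¹))
  rw [zero_add] at this
  refine this.congr fun n => ?_
  ring

/-- On a countable space, convergence of the masses of all points to those of a probability measure
implies weak convergence. -/
theorem ProbabilityMeasure.tendsto_of_tendsto_singleton {E : Type*} [MeasurableSpace E]
    [TopologicalSpace E] [OpensMeasurableSpace E] [HasOuterApproxClosed E] [Countable E]
    [MeasurableSingletonClass E] {μ : ℕ → ProbabilityMeasure E} {ν : ProbabilityMeasure E}
    (h : ∀ x, Tendsto (fun n => (μ n : Measure E) {x}) atTop (𝓝 ((ν : Measure E) {x}))) :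
    Tendsto μ atTop (𝓝 ν) := by
  -- The limit mass of an open set is approximated from below by finite subsets, where convergence
  -- of point masses is enough; the limit being a probability measure, no mass escapes.
  refine tendsto_of_forall_isOpen_le_liminf' fun G _ => ?_
  refine le_of_forall_lt fun c hc => ?_
  have h1 : (ν : Measure E) G = ∑' x : G, (ν : Measure E) {(x : E)} := by
    rw [← measure_biUnion G.to_countable (fun x _ y _ hxy => by simpa using hxy)
      fun x _ => measurableSet_singleton x]
    simp
  rw [h1, ENNReal.tsum_eq_iSup_sum, lt_iSup_iff] at hc
  obtain ⟨s, hs⟩ := hc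
  have h2 : Tendsto (fun n => ∑ x ∈ s, (μ n : Measure E) {(x : E)}) atTop
      (𝓝 (∑ x ∈ s, (ν : Measure E) {(x : E)})) := tendsto_finsetSum _ fun x _ => h x
  refine hs.trans_le (h2.liminf_eq.symm.le.trans (liminf_le_liminf (Eventually.of_forall fun n => ?_)))
  have h3 : ∑ x ∈ s, (μ n : Measure E) {(x : E)} = (μ n : Measure E) (⋃ x ∈ s, {(x : E)}) := by
    rw [measure_biUnion_finset]
    · intro x _ y _ hxy
      simpa [Function.onFun] using fun h => hxy (Subtype.ext h)
    · exact fun x _ => measurableSet_singleton _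
  rw [h3]
  refine measure_mono ?_
  intro y hy
  simp only [Set.mem_iUnion, Set.mem_singleton_iff] at hy
  obtain ⟨x, -, rfl⟩ := hy
  exact x.2

/-! ### The Poisson limit of the counts -/

namespace Matching

theorem tendsto_prob_patternCount (w : Fin 3 → ℕ) :
    Tendsto (fun n => prob fun m : Matching n => patternCount m = w) atTop
      (𝓝 (Real.exp (-3) * ∏ t, ((w t).factorial : ℝ)⁻¹)) := by
  classical
  refine tendsto_of_recursion (p := fun n w => prob fun m : Matching n => patternCount m = w)
    (C := 32) (fun _ _ => prob_nonneg _) (fun _ _ => prob_le_one _) ?_ ?_ w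
  · intro t v
    refine squeeze_zero_norm' ?_ (tendsto_const_div_atTop_nhds_zero_nat (22785 : ℝ))
    filter_upwards [eventually_ge_atTop 5] with n hn
    exact abs_recursion_le hn t v
  · intro K hK
    have hK' : (0 : ℝ) < K := by exact_mod_cast hK
    filter_upwards [eventually_ge_atTop 5] with n hn
    set B : Finset (Fin 3 → ℕ) := Fintype.piFinset fun _ => Finset.range K
    have h1 : ∑ w ∈ B, prob (fun m : Matching n => patternCount m = w) =
        prob fun m : Matching n => patternCount m ∈ B := by
      unfold prob
      rw [← mean_sum]
      refine mean_congr fun m => ?_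
      by_cases h : patternCount m ∈ B
      · rw [ind_of h, Finset.sum_eq_single_of_mem _ h]
        · exact ind_of rfl
        · exact fun w _ hw => ind_of_not (Ne.symm hw)
      · rw [ind_of_not h]
        exact Finset.sum_eq_zero fun w hw => ind_of_not fun h' => h (h' ▸ hw)
    -- Markov's inequality: outside the box some count, hence the total number of patterns, is at
    -- least K.
    have h2 : prob (fun m : Matching n => ¬ patternCount m ∈ B) ≤ 32 / K := by
      rw [le_div_iff₀ hK']
      unfold prob
      rw [← mean_mul_right]
      refine le_trans (mean_mono fun m => ?_) (mean_card_patterns_le hn)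
      by_cases h : patternCount m ∈ B
      · rw [ind_of_not (not_not.2 h), zero_mul]
        positivity
      · rw [ind_of h, one_mul, Nat.cast_le]
        simp only [B, Fintype.mem_piFinset, Finset.mem_range, not_forall, not_lt] at h
        obtain ⟨t, ht⟩ := h
        exact ht.trans (Finset.card_filter_le _ _)
    have h3 := prob_not fun m : Matching n => patternCount m ∈ B
    rw [h1, abs_le]
    constructor
    · linarith
    · have := prob_le_one fun m : Matching n => patternCount m ∈ B
      have : (0 : ℝ) ≤ 32 / K := by positivity
      linarith

theorem count_eq_iff {n : ℕ} (m : Matching n) (x : ℕ × ℕ × ℕ) :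
    (m.countX, m.countY, m.countZ) = x ↔ patternCount m = ![x.1, x.2.1, x.2.2] := by
  rw [countX_eq, countY_eq, countZ_eq, Prod.ext_iff, Prod.ext_iff, funext_iff, Fin.forall_fin_succ,
    Fin.forall_fin_succ, Fin.forall_fin_one]
  rfl

theorem tendstoInDistribution_count :
    TendstoInDistribution
      (fun (n : ℕ) (m : Matching n) => (m.countX, m.countY, m.countZ)) atTop id
      uniformMatching
      ((poissonMeasure 1).prod ((poissonMeasure 1).prod (poissonMeasure 1))) where
  forall_aemeasurable n := Measurable.aemeasurable (measurable_of_finite _)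
  aemeasurable_limit := aemeasurable_id
  tendsto := by
    refine ProbabilityMeasure.tendsto_of_tendsto_singleton fun x => ?_
    have e1 : ∀ n, (uniformMatching n).map
        (fun m : Matching n => (m.countX, m.countY, m.countZ)) {x} =
        ENNReal.ofReal (prob fun m : Matching n => patternCount m = ![x.1, x.2.1, x.2.2]) := by
      intro n
      rw [Measure.map_apply (measurable_of_finite _) (measurableSet_singleton x),
        ← real_uniformMatching, measureReal_def, ENNReal.ofReal_toReal (measure_ne_top _ _)]
      congr 1
      ext m
      exact count_eq_iff m x
    have e2 : (((poissonMeasure 1).prod ((poissonMeasure 1).prod (poissonMeasure 1))).map id) {x} =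
        ENNReal.ofReal (Real.exp (-3) *
          ∏ t, (((![x.1, x.2.1, x.2.2] : Fin 3 → ℕ) t).factorial : ℝ)⁻¹) := by
      obtain ⟨a, b, c⟩ := x
      rw [Measure.map_id, ← Set.singleton_prod_singleton, ← Set.singleton_prod_singleton,
        Measure.prod_prod, Measure.prod_prod, poissonMeasure_singleton, poissonMeasure_singleton,
        poissonMeasure_singleton, ← ENNReal.ofReal_mul (by positivity),
        ← ENNReal.ofReal_mul (by positivity)]
      congr 1
      have : Real.exp (-3) = Real.exp (-1) * (Real.exp (-1) * Real.exp (-1)) := by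
        rw [← Real.exp_add, ← Real.exp_add]; norm_num
      rw [this]
      simp [Fin.prod_univ_succ]
      field_simp
    simp only [ProbabilityMeasure.coe_mk]
    rw [e2]
    simp only [e1]
    exact (ENNReal.continuous_ofReal.tendsto _).comp (tendsto_prob_patternCount _)

end Matching

/-! ### Arcs, closed sets, and decompositions with k ≥ 3 -/

/-- The `l` consecutive points starting at `a`. -/
def arc (N a l : ℕ) : Finset (Fin N) :=
  (Finset.univ : Finset (Fin N)).filter fun i => ∃ t ∈ Finset.range l, (i : ℕ) = (a + t) % N

theorem mem_arc {N a l : ℕ} {i : Fin N} : i ∈ arc N a l ↔ ∃ t < l, (i : ℕ) = (a + t) % N := by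
  simp [arc]

theorem arc_mod (N a l : ℕ) : arc N (a % N) l = arc N a l := by
  ext i
  simp only [mem_arc, Nat.mod_add_mod]

theorem card_arc {N a l : ℕ} (hN : 0 < N) (hl : l ≤ N) : (arc N a l).card = l := by
  have h : arc N a l = (Finset.range l).image fun t => (⟨(a + t) % N, Nat.mod_lt _ hN⟩ : Fin N) := by
    ext i
    simp only [mem_arc, Finset.mem_image, Finset.mem_range, Fin.ext_iff]
    exact exists_congr fun t => and_congr_right fun _ => eq_comm
  rw [h, Finset.card_image_of_injOn, Finset.card_range]
  intro s hs t ht hst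
  simp only [Finset.coe_range, Set.mem_Iio] at hs ht
  simp only [Fin.mk.injEq] at hst
  have h1 : s ≡ t [MOD N] := Nat.ModEq.add_left_cancel' a hst
  exact h1.eq_of_lt_of_lt (by omega) (by omega)

/-- An interval may be given with a length exceeding N; truncating it at N makes its length equal to
its cardinality. -/
theorem IsCircularInterval.exists_eq_arc {N : ℕ} (hN : 0 < N) {S : Finset (Fin N)}
    (h : IsCircularInterval S) : ∃ a < N, S = arc N a S.card := by
  obtain ⟨a, l, h⟩ := h
  have h1 : S = arc N a (min l N) := by
    ext i
    rw [h, mem_arc]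
    constructor
    · rintro ⟨t, ht, hi⟩
      refine ⟨t % N, lt_min ((Nat.mod_le t N).trans_lt ht) (Nat.mod_lt _ hN), ?_⟩
      rw [hi, Nat.add_mod_mod]
    · rintro ⟨t, ht, hi⟩
      exact ⟨t, ht.trans_le (min_le_left _ _), hi⟩
  refine ⟨a % N, Nat.mod_lt _ hN, ?_⟩
  have h2 : S.card = min l N := by rw [h1, card_arc hN (min_le_right _ _)]
  rw [arc_mod, h2]
  exact h1

namespace Matching

variable {n : ℕ}

/-- No chord leaves `S`. -/
def IsClosedOn (S : Finset (Fin (2 * n))) (m : Matching n) : Prop := ∀ i ∈ S, m i ∈ S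

theorem IsClosedOn.two_mul_card_chords {S : Finset (Fin (2 * n))} {m : Matching n}
    (h : IsClosedOn S m) : 2 * (m.chords.filter fun c => c ⊆ S).card = S.card := by
  classical
  have h1 : (m.chords.filter fun c => c ⊆ S) = S.image fun i => {i, m i} := by
    ext c
    simp only [chords, Finset.mem_filter, Finset.mem_image, Finset.mem_univ, true_and]
    constructor
    · rintro ⟨⟨i, rfl⟩, hi⟩
      exact ⟨i, hi (by simp), rfl⟩
    · rintro ⟨i, hi, rfl⟩
      refine ⟨⟨i, rfl⟩, ?_⟩
      intro j hj
      rcases Finset.mem_insert.1 hj with rfl | hj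
      · exact hi
      · rw [Finset.mem_singleton.1 hj]
        exact h i hi
  rw [h1, Finset.card_eq_sum_card_image (fun i => ({i, m i} : Finset (Fin (2 * n)))) S,
    Finset.sum_const_nat (m := 2), mul_comm]
  intro c hc
  obtain ⟨i, hi, rfl⟩ := Finset.mem_image.1 hc
  have h2 : (S.filter fun j => ({j, m j} : Finset (Fin (2 * n))) = {i, m i}) = {i, m i} := by
    ext j
    simp only [Finset.mem_filter, pair_eq_pair_iff, Finset.mem_insert, Finset.mem_singleton]
    constructor
    · rintro ⟨-, ⟨h, -⟩ | ⟨h, -⟩⟩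
      · exact Or.inl h
      · exact Or.inr h
    · rintro (rfl | rfl)
      · exact ⟨hi, Or.inl ⟨rfl, rfl⟩⟩
      · exact ⟨h i hi, Or.inr ⟨rfl, m.apply_apply i⟩⟩
  rw [h2, Finset.card_pair (m.apply_ne i).symm]

theorem _root_.IsDecomposition.isClosedOn {m : Matching n} {k : ℕ}
    {C : Fin 4 → Finset (Fin (2 * n))} (h : IsDecomposition m k C) :
    IsClosedOn (C 0 ∪ C 2) m ∧ IsClosedOn (C 1 ∪ C 3) m := by
  have hd : ∀ j j', j ≠ j' → ∀ i, i ∈ C j → i ∉ C j' := fun j j' hj i hi hi' =>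
    hj ((h.partition i).unique hi hi')
  have key : ∀ i, (i ∈ C 0 ∪ C 2 ∧ m i ∈ C 0 ∪ C 2) ∨ (i ∈ C 1 ∪ C 3 ∧ m i ∈ C 1 ∪ C 3) := by
    intro i
    rcases h.chords_subset {i, m i} (Finset.mem_image_of_mem _ (Finset.mem_univ i)) with hc | hc
    · exact Or.inl ⟨hc (by simp), hc (by simp)⟩
    · exact Or.inr ⟨hc (by simp), hc (by simp)⟩
  have hdis : ∀ i, i ∈ C 0 ∪ C 2 → i ∉ C 1 ∪ C 3 := by
    intro i hi hi'
    rw [Finset.mem_union] at hi hi'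
    rcases hi with hi | hi <;> rcases hi' with hi' | hi'
    · exact hd 0 1 (by decide) i hi hi'
    · exact hd 0 3 (by decide) i hi hi'
    · exact hd 2 1 (by decide) i hi hi'
    · exact hd 2 3 (by decide) i hi hi'
  constructor
  · intro i hi
    rcases key i with h | h
    · exact h.2
    · exact absurd h.1 (hdis i hi)
  · intro i hi
    rcases key i with h | h
    · exact absurd hi (hdis i h.1)
    · exact h.2

theorem _root_.IsDecomposition.card_inner {m : Matching n} {k : ℕ}
    {C : Fin 4 → Finset (Fin (2 * n))} (h : IsDecomposition m k C) :
    (C 1).card + (C 3).card = 2 * k := by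
  rw [← h.card_chords, h.isClosedOn.2.two_mul_card_chords, Finset.card_union_of_disjoint]
  rw [Finset.disjoint_left]
  exact fun i hi hi' => absurd ((h.partition i).unique hi hi') (by decide)

theorem _root_.IsDecomposition.card_outer {m : Matching n} {k : ℕ}
    {C : Fin 4 → Finset (Fin (2 * n))} (h : IsDecomposition m k C) :
    (C 0).card + (C 2).card + 2 * k = 2 * n := by
  have h1 : (Finset.univ : Finset (Fin (2 * n))) = Finset.univ.biUnion C := by
    ext i
    obtain ⟨j, hj, -⟩ := h.partition i
    simp only [Finset.mem_univ, Finset.mem_biUnion, true_and, true_iff]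
    exact ⟨j, hj⟩
  have h2 : 2 * n = ∑ j, (C j).card := by
    rw [← Finset.card_biUnion, ← h1, Finset.card_univ, Fintype.card_fin]
    intro j _ j' _ hj
    exact Finset.disjoint_left.2 fun i hi hi' => hj ((h.partition i).unique hi hi')
  rw [Fin.sum_univ_four] at h2
  have := h.card_inner
  omega

/-- An upper bound for the probability that no chord leaves a given set of `2j` points. -/
noncomputable def closedBound (n j : ℕ) : ℝ :=
  ∏ i ∈ Finset.range j, ((2 * i + 1 : ℝ) / (2 * n - 2 * i - 1))

theorem isClosedOn_of_conj {S : Finset (Fin (2 * n))} {σ : Equiv.Perm (Fin (2 * n))}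
    (hσ : ∀ s ∈ S, σ s = s) {m : Matching n} (h : IsClosedOn S (conj σ m)) : IsClosedOn S m := by
  intro i hi
  have h1 := h i hi
  rw [conj_apply, σ.symm_apply_eq.2 (hσ i hi).symm] at h1
  have h2 := hσ _ h1
  rw [σ.injective h2] at h1
  exact h1

/-- A fixed point of S has 2j+1 possible partners in S. Removing such a chord leaves a closed set of
2j points, and adding the chord back costs 1/(2n-2j-1). -/
theorem prob_isClosedOn_le (j : ℕ) (hj : j ≤ n) (S : Finset (Fin (2 * n))) (hS : S.card = 2 * j) :
    prob (IsClosedOn S) ≤ closedBound n j := by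
  classical
  induction j generalizing S with
  | zero =>
    simpa [closedBound] using prob_le_one (IsClosedOn S)
  | succ j ih =>
    obtain ⟨a, ha⟩ : S.Nonempty := Finset.card_pos.1 (by omega)
    have hj' : (j : ℝ) + 1 ≤ n := by exact_mod_cast hj
    have hpos : (0 : ℝ) < 2 * n - 2 * j - 1 := by linarith
    have h1 : ∀ m, IsClosedOn S m →
        ∃ b ∈ S.erase a, IsClosedOn ((S.erase a).erase b) m ∧ m a = b := by
      intro m hm
      refine ⟨m a, Finset.mem_erase.2 ⟨m.apply_ne a, hm a ha⟩, ?_, rfl⟩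
      intro i hi
      simp only [Finset.mem_erase] at hi ⊢
      refine ⟨fun h => hi.2.1 (m.injective h), fun h => hi.1 ?_, hm i hi.2.2⟩
      rw [← h, apply_apply]
    refine (prob_mono h1).trans ((prob_exists_le _ _).trans ?_)
    have h2 : ∀ b ∈ S.erase a, prob (fun m => IsClosedOn ((S.erase a).erase b) m ∧ m a = b) ≤
        closedBound n j / (2 * n - 2 * j - 1) := by
      intro b hb
      have hc : ((S.erase a).erase b).card = 2 * j := by
        rw [Finset.card_erase_of_mem hb, Finset.card_erase_of_mem ha, hS]
        omega
      have h3 := prob_and_apply_eq_le (IsClosedOn ((S.erase a).erase b)) ((S.erase a).erase b)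
        (fun σ hσ m hm => isClosedOn_of_conj hσ hm) (a := a) (b := b) (by simp) (by simp)
        (Finset.ne_of_mem_erase hb).symm
      rw [hc] at h3
      push_cast at h3
      rw [le_div_iff₀ hpos]
      calc _ = prob (fun m => IsClosedOn ((S.erase a).erase b) m ∧ m a = b) *
            (2 * n - 1 - 2 * j) := by ring
        _ ≤ _ := h3
        _ ≤ _ := ih (by omega) _ hc
    refine (Finset.sum_le_sum h2).trans ?_
    rw [Finset.sum_const, Finset.card_erase_of_mem ha, hS, nsmul_eq_mul]
    have e : closedBound n (j + 1) =
        closedBound n j * ((2 * j + 1) / (2 * n - 2 * j - 1)) := Finset.prod_range_succ _ _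
    have : ((2 * (j + 1) - 1 : ℕ) : ℝ) = 2 * j + 1 := by
      rw [Nat.cast_sub (by omega)]
      push_cast
      ring
    rw [this, e]
    exact le_of_eq (by ring)

theorem closedBound_factor_le {i : ℕ} (hi : 2 * i + 1 ≤ n) :
    (2 * i + 1 : ℝ) / (2 * n - 2 * i - 1) ≤ (2 * i + 1) / n := by
  have hi' : (2 * i + 1 : ℝ) ≤ n := by exact_mod_cast hi
  have : (0 : ℝ) ≤ i := Nat.cast_nonneg i
  exact div_le_div_of_nonneg_left (by positivity) (by linarith) (by linarith)

theorem closedBound_factor_nonneg {i : ℕ} (hi : 2 * i + 1 ≤ n) :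
    (0 : ℝ) ≤ (2 * i + 1 : ℝ) / (2 * n - 2 * i - 1) := by
  have hi' : (2 * i + 1 : ℝ) ≤ n := by exact_mod_cast hi
  have : (0 : ℝ) ≤ i := Nat.cast_nonneg i
  exact div_nonneg (by positivity) (by linarith)

theorem closedBound_le {j : ℕ} (hj : 2 * j ≤ n + 1) :
    closedBound n j ≤ (∏ i ∈ Finset.range j, (2 * i + 1 : ℝ)) / n ^ j := by
  calc closedBound n j ≤ ∏ i ∈ Finset.range j, (2 * i + 1 : ℝ) / n := by
        refine Finset.prod_le_prod (fun i hi => closedBound_factor_nonneg ?_)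
          fun i hi => closedBound_factor_le ?_ <;>
        · rw [Finset.mem_range] at hi
          omega
    _ = _ := by rw [Finset.prod_div_distrib, Finset.prod_const, Finset.card_range]

/-- The additional factors are at most 1 as long as 2i+1 ≤ n, that is, up to half of the chords. -/
theorem closedBound_le_of_le {j k : ℕ} (hjk : j ≤ k) (hk : 2 * k ≤ n + 1) :
    closedBound n k ≤ closedBound n j := by
  unfold closedBound
  rw [← Finset.prod_range_mul_prod_Ico _ hjk]
  refine mul_le_of_le_one_right ?_ ?_
  · refine Finset.prod_nonneg fun i hi => closedBound_factor_nonneg ?_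
    rw [Finset.mem_range] at hi
    omega
  · refine Finset.prod_le_one (fun i hi => closedBound_factor_nonneg ?_) fun i hi => ?_
    · rw [Finset.mem_Ico] at hi
      omega
    · rw [Finset.mem_Ico] at hi
      refine (closedBound_factor_le (by omega)).trans ?_
      have h : 2 * i + 1 ≤ n := by omega
      exact div_le_one_of_le₀ (by exact_mod_cast h) (Nat.cast_nonneg n)

/-- No chord leaves the union of two given arcs with `2j` points in total. -/
def ClosedOnArcs (j a b s : ℕ) (m : Matching n) : Prop :=
  (arc (2 * n) a s ∪ arc (2 * n) b (2 * j - s)).card = 2 * j ∧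
    IsClosedOn (arc (2 * n) a s ∪ arc (2 * n) b (2 * j - s)) m

theorem prob_closedOnArcs_le (j a b s : ℕ) (hj : j ≤ n) (hj0 : 0 ≤ closedBound n j) :
    prob (ClosedOnArcs (n := n) j a b s) ≤ closedBound n j := by
  by_cases h : (arc (2 * n) a s ∪ arc (2 * n) b (2 * j - s)).card = 2 * j
  · exact (prob_mono fun m hm => hm.2).trans (prob_isClosedOn_le j hj _ h)
  · rw [prob_eq_zero fun m hm => h hm.1]
    exact hj0

theorem closedBound_nonneg {j : ℕ} (hj : 2 * j ≤ n + 1) : 0 ≤ closedBound n j := by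
  refine Finset.prod_nonneg fun i hi => closedBound_factor_nonneg ?_
  rw [Finset.mem_range] at hi
  omega

theorem closedOnArcs_of_disjoint (hn : 0 < n) {A B : Finset (Fin (2 * n))} {m : Matching n} {j : ℕ}
    (hA : IsCircularInterval A) (hB : IsCircularInterval B) (hd : Disjoint A B)
    (hc : A.card + B.card = 2 * j) (h : IsClosedOn (A ∪ B) m) :
    ∃ a < 2 * n, ∃ b < 2 * n, ∃ s < 2 * j + 1, A = arc (2 * n) a s ∧ ClosedOnArcs j a b s m := by
  obtain ⟨a, ha, hA⟩ := hA.exists_eq_arc (by omega)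
  obtain ⟨b, hb, hB⟩ := hB.exists_eq_arc (by omega)
  have h1 : B.card = 2 * j - A.card := by omega
  rw [h1] at hB
  refine ⟨a, ha, b, hb, A.card, by omega, hA, ?_⟩
  rw [ClosedOnArcs, ← hA, ← hB]
  exact ⟨by rw [Finset.card_union_of_disjoint hd, hc], h⟩

/-- The side with fewer chords is used, so that j ≤ n/2. The case j = 2 is separated because a union
over all pairs of arcs would only give O(1); there the outer side is used, and one of its arcs
contains the point 0. -/
theorem closedOnArcs_of_isKDecomposable {m : Matching n} {k : ℕ} (hk : 2 < k) (hkn : k + 2 ≤ n)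
    (h : m.IsKDecomposable k) :
    (∃ j ∈ Finset.Icc 3 (n / 2), ∃ x ∈ Finset.range (2 * n) ×ˢ Finset.range (2 * n) ×ˢ
        Finset.range (2 * j + 1), ClosedOnArcs j x.1 x.2.1 x.2.2 m) ∨
      ∃ x ∈ Finset.range 4 ×ˢ Finset.range (2 * n) ×ˢ Finset.range 5,
        ClosedOnArcs 2 (2 * n - x.1) x.2.1 x.2.2 m := by
  obtain ⟨C, hC⟩ := h
  have hd : ∀ j j', j ≠ j' → Disjoint (C j) (C j') := fun j j' hj =>
    Finset.disjoint_left.2 fun i hi hi' => hj ((hC.partition i).unique hi hi')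
  have hin := hC.card_inner
  have hout := hC.card_outer
  by_cases h1 : 2 * k ≤ n
  · left
    obtain ⟨a, ha, b, hb, s, hs, -, h2⟩ := closedOnArcs_of_disjoint (by omega) (hC.circular 1)
      (hC.circular 3) (hd 1 3 (by decide)) hin hC.isClosedOn.2
    refine ⟨k, Finset.mem_Icc.2 ⟨hk, by omega⟩, (a, b, s), ?_, h2⟩
    simp only [Finset.mem_product, Finset.mem_range]
    exact ⟨ha, hb, hs⟩
  · have hout' : (C 0).card + (C 2).card = 2 * (n - k) := by omega
    obtain ⟨a, ha, b, hb, s, hs, hA, h2⟩ := closedOnArcs_of_disjoint (by omega) (hC.circular 0)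
      (hC.circular 2) (hd 0 2 (by decide)) hout' hC.isClosedOn.1
    by_cases h3 : n - k = 2
    · right
      -- The point 0 has some position t < s ≤ 4 in the first arc, so that arc starts at -t modulo
      -- 2n: four choices instead of 2n.
      obtain ⟨i, hi, hi0⟩ := hC.first
      rw [hA] at hi
      obtain ⟨t, ht, hit⟩ := mem_arc.1 hi
      rw [h3] at h2 hs
      have hs5 : s < 5 := by omega
      refine ⟨(t, b, s), ?_, ?_⟩
      · simp only [Finset.mem_product, Finset.mem_range]
        exact ⟨by omega, hb, hs5⟩
      · have h4 : arc (2 * n) (2 * n - t) s = arc (2 * n) a s := by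
          have h5 : 2 * n ∣ a + t := Nat.dvd_of_mod_eq_zero (by omega)
          obtain ⟨c, hc⟩ := h5
          have hc2 : c < 2 := by
            by_contra hc2
            have : 2 * n * 2 ≤ 2 * n * c := Nat.mul_le_mul_left _ (by omega)
            omega
          have hmod : (2 * n - t) % (2 * n) = a % (2 * n) := by
            interval_cases c
            · have : a = 0 := by omega
              have : t = 0 := by omega
              subst_vars
              simp
            · congr 1
              omega
          rw [← arc_mod, hmod, arc_mod]
        simp only [ClosedOnArcs, h4]
        exact h2
    · left
      refine ⟨n - k, Finset.mem_Icc.2 ⟨by omega, by omega⟩, (a, b, s), ?_, h2⟩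
      simp only [Finset.mem_product, Finset.mem_range]
      exact ⟨ha, hb, hs⟩

theorem prob_large_decomposable_le (hn : 10 ≤ n) :
    prob (fun m : Matching n => ∃ k : ℕ, 2 < k ∧ k + 2 ≤ n ∧ m.IsKDecomposable k) ≤ 8100 / n := by
  have hn' : (10 : ℝ) ≤ n := by exact_mod_cast hn
  have hn0 : (0 : ℝ) < n := by linarith
  have e2 : closedBound n 2 ≤ 3 / n ^ 2 := by
    have := closedBound_le (n := n) (j := 2) (by omega)
    norm_num [Finset.prod_range_succ] at this
    exact this
  have e3 : closedBound n 3 ≤ 15 / n ^ 3 := by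
    have := closedBound_le (n := n) (j := 3) (by omega)
    norm_num [Finset.prod_range_succ] at this
    exact this
  have e4 : closedBound n 4 ≤ 105 / n ^ 4 := by
    have := closedBound_le (n := n) (j := 4) (by omega)
    norm_num [Finset.prod_range_succ] at this
    exact this
  have e5 : closedBound n 5 ≤ 945 / n ^ 5 := by
    have := closedBound_le (n := n) (j := 5) (by omega)
    norm_num [Finset.prod_range_succ] at this
    exact this
  have hterm : ∀ j ∈ Finset.Icc 3 (n / 2), prob (fun m : Matching n =>
      ∃ x ∈ Finset.range (2 * n) ×ˢ Finset.range (2 * n) ×ˢ Finset.range (2 * j + 1),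
        ClosedOnArcs j x.1 x.2.1 x.2.2 m) ≤ ind (3 = j) * (420 / (n : ℝ)) + 7560 / (n : ℝ) ^ 2 := by
    intro j hj
    rw [Finset.mem_Icc] at hj
    have h1 : prob (fun m : Matching n =>
        ∃ x ∈ Finset.range (2 * n) ×ˢ Finset.range (2 * n) ×ˢ Finset.range (2 * j + 1),
          ClosedOnArcs j x.1 x.2.1 x.2.2 m) ≤ 4 * (n : ℝ) ^ 2 * (2 * j + 1) * closedBound n j := by
      refine (prob_exists_le _ _).trans ((Finset.sum_le_sum fun x _ => prob_closedOnArcs_le j _ _ _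
        (by omega) (closedBound_nonneg (by omega))).trans (le_of_eq ?_))
      rw [Finset.sum_const, Finset.card_product, Finset.card_product, Finset.card_range,
        Finset.card_range, nsmul_eq_mul]
      push_cast
      ring
    refine h1.trans ?_
    -- The value j = 3 gives the leading 1/n. The other terms must be O(1/n²), since there are up to
    -- n/2 of them; from j = 5 on, monotonicity of the bound compensates for the crude estimate 2j+1
    -- ≤ 2n.
    rcases Nat.lt_or_ge j 5 with h5 | h5
    · have : j = 3 ∨ j = 4 := by omega
      rcases this with rfl | rfl
      · rw [ind_of rfl, one_mul]
        calc 4 * (n : ℝ) ^ 2 * (2 * (3 : ℕ) + 1) * closedBound n 3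
            ≤ 4 * (n : ℝ) ^ 2 * (2 * (3 : ℕ) + 1) * (15 / (n : ℝ) ^ 3) := by gcongr
          _ = 420 / (n : ℝ) := by
              push_cast
              field_simp
              norm_num
          _ ≤ _ := le_add_of_nonneg_right (by positivity)
      · rw [ind_of_not (by norm_num), zero_mul, zero_add]
        calc 4 * (n : ℝ) ^ 2 * (2 * (4 : ℕ) + 1) * closedBound n 4
            ≤ 4 * (n : ℝ) ^ 2 * (2 * (4 : ℕ) + 1) * (105 / (n : ℝ) ^ 4) := by gcongr
          _ = 3780 / (n : ℝ) ^ 2 := by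
              push_cast
              field_simp
              norm_num
          _ ≤ _ := by gcongr; norm_num
    · rw [ind_of_not (by omega), zero_mul, zero_add]
      have hj2 : (2 * j + 1 : ℝ) ≤ 2 * n := by
        have : 2 * j + 1 ≤ 2 * n := by omega
        exact_mod_cast this
      calc 4 * (n : ℝ) ^ 2 * (2 * j + 1) * closedBound n j
          ≤ 4 * (n : ℝ) ^ 2 * (2 * (n : ℝ)) * (945 / (n : ℝ) ^ 5) := by
            have h6 := (closedBound_le_of_le h5 (by omega : 2 * j ≤ n + 1)).trans e5
            have h7 := closedBound_nonneg (n := n) (j := j) (by omega)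
            gcongr
        _ = 7560 / (n : ℝ) ^ 2 := by
            field_simp
            norm_num
  have hlast : prob (fun m : Matching n =>
      ∃ x ∈ Finset.range 4 ×ˢ Finset.range (2 * n) ×ˢ Finset.range 5,
        ClosedOnArcs 2 (2 * n - x.1) x.2.1 x.2.2 m) ≤ 120 / n := by
    refine (prob_exists_le _ _).trans ((Finset.sum_le_sum fun x _ =>
      (prob_closedOnArcs_le 2 _ _ _ (by omega) (closedBound_nonneg (by omega))).trans e2).trans
        (le_of_eq ?_))
    rw [Finset.sum_const, Finset.card_product, Finset.card_product, Finset.card_range,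
      Finset.card_range, Finset.card_range, nsmul_eq_mul]
    push_cast
    field_simp
    norm_num
  have hsum : ∑ j ∈ Finset.Icc 3 (n / 2), (ind (3 = j) * (420 / (n : ℝ)) + 7560 / (n : ℝ) ^ 2) ≤
      420 / (n : ℝ) + 7560 / (n : ℝ) := by
    rw [Finset.sum_add_distrib]
    refine add_le_add ?_ ?_
    · rw [Finset.sum_eq_single_of_mem 3 (Finset.mem_Icc.2 ⟨le_rfl, by omega⟩)]
      · rw [ind_of rfl, one_mul]
      · intro j _ hj
        rw [ind_of_not (Ne.symm hj), zero_mul]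
    · rw [Finset.sum_const, nsmul_eq_mul, Nat.card_Icc]
      calc ((n / 2 + 1 - 3 : ℕ) : ℝ) * (7560 / (n : ℝ) ^ 2) ≤ (n : ℝ) * (7560 / (n : ℝ) ^ 2) := by
            gcongr
            omega
        _ = 7560 / (n : ℝ) := by field_simp
  calc prob (fun m : Matching n => ∃ k : ℕ, 2 < k ∧ k + 2 ≤ n ∧ m.IsKDecomposable k)
      ≤ _ := prob_mono fun m ⟨k, hk, hkn, h⟩ => closedOnArcs_of_isKDecomposable hk hkn h
    _ ≤ _ := prob_or_le _ _
    _ ≤ (420 / (n : ℝ) + 7560 / n) + 120 / n := add_le_add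
        ((prob_exists_le _ _).trans ((Finset.sum_le_sum hterm).trans hsum)) hlast
    _ = 8100 / n := by ring

end Matching

/-! ### 2-decompositions and patterns -/

namespace Matching

variable {n : ℕ}

theorem arc_zero (N a : ℕ) : arc N a 0 = ∅ := by
  ext i; simp [mem_arc]

theorem arc_succ (p : Fin (2 * n)) (l : ℕ) :
    arc (2 * n) p (l + 1) = insert p (arc (2 * n) (next p) l) := by
  ext i
  have h : ∀ t : ℕ, ((p : ℕ) + (t + 1)) % (2 * n) = ((next p : ℕ) + t) % (2 * n) := by
    intro t
    rw [next, Nat.mod_add_mod]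
    congr 1
    ring
  rw [Finset.mem_insert, mem_arc, mem_arc]
  constructor
  · rintro ⟨t, ht, hi⟩
    rcases t with _ | t
    · left
      rw [Fin.ext_iff, hi, add_zero, Nat.mod_eq_of_lt p.isLt]
    · exact Or.inr ⟨t, by omega, by rw [hi, h]⟩
  · rintro (rfl | ⟨t, ht, hi⟩)
    · exact ⟨0, by omega, by rw [add_zero, Nat.mod_eq_of_lt i.isLt]⟩
    · exact ⟨t + 1, by omega, by rw [hi, h]⟩

theorem exists_pattern_of_apply_eq_next {m : Matching n} {i : Fin (2 * n)} (h : m i = next i) :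
    (patterns m).Nonempty := by
  refine ⟨(0, i, next i), ?_⟩
  simp [mem_patterns, Pattern.Valid, Pattern.Occurs, Pattern.a, Pattern.b, Pattern.c, Pattern.d, h]

theorem exists_pattern_of_apply_eq_next_next {m : Matching n} {i : Fin (2 * n)}
    (h : m i = next (next i)) : (patterns m).Nonempty := by
  refine ⟨(1, i, next (next i)), ?_⟩
  simp [mem_patterns, Pattern.Valid, Pattern.Occurs, Pattern.a, Pattern.b, Pattern.c, Pattern.d, h]

theorem exists_pattern_of_pairs {m : Matching n} {p q : Fin (2 * n)} (hqp : q ≠ p)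
    (hqp' : q ≠ next p) (hpq' : p ≠ next q)
    (h : m p = q ∧ m (next p) = next q ∨ m p = next q ∧ m (next p) = q) :
    (patterns m).Nonempty := by
  rcases lt_or_gt_of_ne hqp with hlt | hlt <;> rcases h with h | h
  · refine ⟨(2, q, p), mem_patterns_two.2 ⟨⟨hqp.symm, hpq', hqp'⟩, ?_⟩⟩
    rw [if_neg hlt.not_gt]
    exact ⟨m.apply_eq_comm.1 h.1, m.apply_eq_comm.1 h.2⟩
  · refine ⟨(2, p, q), mem_patterns_two.2 ⟨⟨hqp, hqp', hpq'⟩, ?_⟩⟩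
    rw [if_pos hlt]
    exact h
  · refine ⟨(2, p, q), mem_patterns_two.2 ⟨⟨hqp, hqp', hpq'⟩, ?_⟩⟩
    rw [if_neg hlt.not_gt]
    exact h
  · refine ⟨(2, q, p), mem_patterns_two.2 ⟨⟨hqp.symm, hpq', hqp'⟩, ?_⟩⟩
    rw [if_pos hlt]
    exact ⟨m.apply_eq_comm.1 h.2, m.apply_eq_comm.1 h.1⟩

/-- Arcs of sizes 2 and 2 contain a chord of length one or are joined to each other by two chords.
With sizes 3 and 1, two of the three consecutive points are joined, as only one can be matched to
the isolated point. With size 4, the second point has a partner at distance one or two. -/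
theorem patterns_nonempty_of_arcs {m : Matching n} {p q : Fin (2 * n)} {s : ℕ}
    (hs : 2 ≤ s) (hs4 : s ≤ 4) (hd : Disjoint (arc (2 * n) p s) (arc (2 * n) q (4 - s)))
    (h : IsClosedOn (arc (2 * n) p s ∪ arc (2 * n) q (4 - s)) m) : (patterns m).Nonempty := by
  have hs' : s = 2 ∨ s = 3 ∨ s = 4 := by omega
  rcases hs' with rfl | rfl | rfl
  · simp only [arc_succ, Nat.reduceSub, arc_zero, insert_empty_eq, IsClosedOn] at h hd
    simp only [Finset.disjoint_left, Finset.mem_union, Finset.mem_insert,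
      Finset.mem_singleton] at h hd
    have hqp : q ≠ p := fun h' => hd (Or.inl rfl) (Or.inl h'.symm)
    have hqp' : q ≠ next p := fun h' => hd (Or.inr rfl) (Or.inl h'.symm)
    have hpq' : p ≠ next q := fun h' => hd (Or.inl rfl) (Or.inr h')
    have h1 := h p (Or.inl (Or.inl rfl))
    have h2 := h (next p) (Or.inl (Or.inr rfl))
    rcases h1 with (h1 | h1) | h1
    · exact absurd h1 (m.apply_ne p)
    · exact exists_pattern_of_apply_eq_next h1
    rcases h2 with (h2 | h2) | h2
    · exact exists_pattern_of_apply_eq_next (m.apply_eq_comm.1 h2)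
    · exact absurd h2 (m.apply_ne _)
    refine exists_pattern_of_pairs hqp hqp' hpq' ?_
    have hne : m p ≠ m (next p) := fun h' => next_ne p (m.injective h').symm
    rcases h1 with h1 | h1 <;> rcases h2 with h2 | h2
    · exact absurd (h1.trans h2.symm) hne
    · exact Or.inl ⟨h1, h2⟩
    · exact Or.inr ⟨h1, h2⟩
    · exact absurd (h1.trans h2.symm) hne
  · simp only [arc_succ, Nat.reduceSub, arc_zero, insert_empty_eq, IsClosedOn] at h hd
    simp only [Finset.mem_union, Finset.mem_insert, Finset.mem_singleton] at h
    have h1 := h p (Or.inl (Or.inl rfl))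
    have h2 := h (next p) (Or.inl (Or.inr (Or.inl rfl)))
    rcases h1 with (h1 | h1 | h1) | h1
    · exact absurd h1 (m.apply_ne p)
    · exact exists_pattern_of_apply_eq_next h1
    · exact exists_pattern_of_apply_eq_next_next h1
    rcases h2 with (h2 | h2 | h2) | h2
    · exact exists_pattern_of_apply_eq_next (m.apply_eq_comm.1 h2)
    · exact absurd h2 (m.apply_ne _)
    · exact exists_pattern_of_apply_eq_next h2
    · exact absurd (m.injective (h2.trans h1.symm)) (next_ne p)
  · simp only [arc_succ, Nat.reduceSub, arc_zero, Finset.union_empty, insert_empty_eq,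
      IsClosedOn] at h
    simp only [Finset.mem_insert, Finset.mem_singleton] at h
    rcases h (next p) (Or.inr (Or.inl rfl)) with h2 | h2 | h2 | h2
    · exact exists_pattern_of_apply_eq_next (m.apply_eq_comm.1 h2)
    · exact absurd h2 (m.apply_ne _)
    · exact exists_pattern_of_apply_eq_next h2
    · exact exists_pattern_of_apply_eq_next_next h2

theorem patterns_nonempty_of_isKDecomposable_two (hn : 0 < n) {m : Matching n}
    (h : m.IsKDecomposable 2) : (patterns m).Nonempty := by
  obtain ⟨C, hC⟩ := h
  have hcard := hC.card_inner
  have hd : Disjoint (C 1) (C 3) := Finset.disjoint_left.2 fun i hi hi' =>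
    absurd ((hC.partition i).unique hi hi') (by decide)
  have hcl := hC.isClosedOn.2
  obtain ⟨a, ha, h1⟩ := (hC.circular 1).exists_eq_arc (by omega)
  obtain ⟨b, hb, h3⟩ := (hC.circular 3).exists_eq_arc (by omega)
  generalize (C 1).card = s at h1 hcard
  generalize (C 3).card = t at h3 hcard
  rw [h1, h3] at hcl hd
  rcases Nat.lt_or_ge s 2 with h2 | h2
  · rw [Finset.union_comm] at hcl
    rw [show s = 4 - t by omega] at hcl hd
    exact patterns_nonempty_of_arcs (p := ⟨b, hb⟩) (q := ⟨a, ha⟩) (by omega) (by omega) hd.symm hcl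
  · rw [show t = 4 - s by omega] at hcl hd
    exact patterns_nonempty_of_arcs (p := ⟨a, ha⟩) (q := ⟨b, hb⟩) h2 (by omega) hd hcl

/-- The points `a, a + 1, …, b - 1`, without wrapping around. -/
def segment (N a b : ℕ) : Finset (Fin N) :=
  (Finset.univ : Finset (Fin N)).filter fun i => a ≤ (i : ℕ) ∧ (i : ℕ) < b

theorem mem_segment {N a b : ℕ} {i : Fin N} :
    i ∈ segment N a b ↔ a ≤ (i : ℕ) ∧ (i : ℕ) < b := by
  simp [segment]

theorem isCircularInterval_segment {N a b : ℕ} (hb : b ≤ N) :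
    IsCircularInterval (segment N a b) := by
  refine ⟨a, b - a, fun i => ?_⟩
  rw [mem_segment]
  constructor
  · rintro ⟨h1, h2⟩
    exact ⟨i - a, by omega, by rw [Nat.add_sub_cancel' h1, Nat.mod_eq_of_lt i.isLt]⟩
  · rintro ⟨t, ht, hi⟩
    rw [Nat.mod_eq_of_lt (by omega)] at hi
    omega

theorem isCircularInterval_outer {N a b : ℕ} (hab : a ≤ b) (hb : b ≤ N) :
    IsCircularInterval ((Finset.univ : Finset (Fin N)).filter
      fun i => (i : ℕ) < a ∨ b ≤ (i : ℕ)) := by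
  refine ⟨b, N - b + a, fun i => ?_⟩
  have hi := i.isLt
  simp only [Finset.mem_filter, Finset.mem_univ, true_and]
  constructor
  · rintro (h | h)
    · refine ⟨N - b + i, by omega, ?_⟩
      rw [show b + (N - b + i) = N + i by omega, Nat.add_mod_left, Nat.mod_eq_of_lt hi]
    · exact ⟨i - b, by omega, by rw [Nat.add_sub_cancel' h, Nat.mod_eq_of_lt hi]⟩
  · rintro ⟨t, ht, h⟩
    rcases Nat.lt_or_ge (b + t) N with h1 | h1
    · rw [Nat.mod_eq_of_lt h1] at h
      omega
    · rw [Nat.mod_eq_sub_mod h1, Nat.mod_eq_of_lt (by omega)] at h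
      omega

/-- The two segments serve as the inner sets, possibly with an empty gap between them. The condition
`0 < a` leaves the point 0 to the wrapped outer arc, as the definition requires. -/
theorem isKDecomposable_of_segments {m : Matching n} {a b c d k : ℕ} (ha : 0 < a) (hab : a ≤ b)
    (hbc : b ≤ c) (hcd : c ≤ d) (hd : d ≤ 2 * n) (hdn : a < 2 * n)
    (hk : (segment (2 * n) a b ∪ segment (2 * n) c d).card = 2 * k)
    (h : IsClosedOn (segment (2 * n) a b ∪ segment (2 * n) c d) m) : m.IsKDecomposable k := by
  classical
  set C : Fin 4 → Finset (Fin (2 * n)) := ![Finset.univ.filter fun i => (i : ℕ) < a ∨ d ≤ (i : ℕ),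
    segment (2 * n) a b, segment (2 * n) b c, segment (2 * n) c d] with hC
  have m0 : ∀ i, i ∈ C 0 ↔ (i : ℕ) < a ∨ d ≤ (i : ℕ) := by intro i; simp [hC]
  have m1 : ∀ i, i ∈ C 1 ↔ a ≤ (i : ℕ) ∧ (i : ℕ) < b := by intro i; simp [hC, mem_segment]
  have m2 : ∀ i, i ∈ C 2 ↔ b ≤ (i : ℕ) ∧ (i : ℕ) < c := by intro i; simp [hC, mem_segment]
  have m3 : ∀ i, i ∈ C 3 ↔ c ≤ (i : ℕ) ∧ (i : ℕ) < d := by intro i; simp [hC, mem_segment]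
  have e13 : C 1 ∪ C 3 = segment (2 * n) a b ∪ segment (2 * n) c d := rfl
  have hcompl : ∀ i, i ∈ C 0 ∪ C 2 ↔ i ∉ C 1 ∪ C 3 := by
    intro i
    simp only [Finset.mem_union, m0, m1, m2, m3]
    omega
  rw [← e13] at h hk
  refine ⟨C, ?_, ?_, ?_, ?_, ?_, ?_⟩
  · intro i
    have : ∃ j, i ∈ C j := by
      by_cases h1 : i ∈ C 1 ∪ C 3
      · rcases Finset.mem_union.1 h1 with h1 | h1
        · exact ⟨1, h1⟩
        · exact ⟨3, h1⟩
      · rcases Finset.mem_union.1 ((hcompl i).2 h1) with h1 | h1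
        · exact ⟨0, h1⟩
        · exact ⟨2, h1⟩
    obtain ⟨j, hj⟩ := this
    refine ⟨j, hj, fun j' hj' => ?_⟩
    fin_cases j <;> fin_cases j' <;>
      simp only [Fin.reduceFinMk, Fin.zero_eta, Fin.mk_one, m0, m1, m2, m3] at hj hj' ⊢ <;> omega
  · intro j
    fin_cases j
    · exact isCircularInterval_outer (by omega) hd
    · exact isCircularInterval_segment (by omega)
    · exact isCircularInterval_segment (by omega)
    · exact isCircularInterval_segment hd
  · exact ⟨⟨0, by omega⟩, (m0 _).2 (Or.inl ha), rfl⟩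
  · intro j j' h0 hjj hne hne'
    have h1 := Finset.min'_mem _ hne
    have h2 := Finset.min'_mem _ hne'
    rw [Fin.lt_def]
    fin_cases j <;> fin_cases j' <;>
      simp only [Fin.reduceFinMk, Fin.zero_eta, Fin.mk_one, m1, m2, m3, lt_self_iff_false,
        Fin.reduceLT] at h0 hjj h1 h2 ⊢ <;> omega
  · intro e he
    obtain ⟨i, -, rfl⟩ := Finset.mem_image.1 he
    by_cases hi : i ∈ C 1 ∪ C 3
    · right
      intro x hx
      rcases Finset.mem_insert.1 hx with rfl | hx
      · exact hi
      · rw [Finset.mem_singleton.1 hx]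
        exact h i hi
    · left
      intro x hx
      rw [hcompl]
      rcases Finset.mem_insert.1 hx with rfl | hx
      · exact hi
      · rw [Finset.mem_singleton.1 hx]
        intro h'
        have := h _ h'
        rw [apply_apply] at this
        exact hi this
  · have := h.two_mul_card_chords
    omega

/-- Serves one-chord patterns: the chord lies in a block of three consecutive points, and `q` will
be the partner of the remaining point of the block. -/
theorem isKDecomposable_two_of_triple {m : Matching n} {j q : Fin (2 * n)}
    (h0 : ((next j : Fin (2 * n)) : ℕ) ≠ 0) (h0' : (next (next j) : ℕ) ≠ 0) (hj : (j : ℕ) ≠ 0)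
    (hq : (q : ℕ) ≠ 0) (hq1 : q ≠ j) (hq2 : q ≠ next j) (hq3 : q ≠ next (next j))
    (h : IsClosedOn {j, next j, next (next j), q} m) : m.IsKDecomposable 2 := by
  have hjlt := j.isLt
  have hqlt := q.isLt
  have v1 : (next j : ℕ) = j + 1 := by
    rw [next_val] at h0 ⊢
    split_ifs at h0 ⊢
    · omega
    · rfl
  have v2 : (next (next j) : ℕ) = j + 2 := by
    rw [next_val, v1] at h0' ⊢
    split_ifs at h0' ⊢
    · omega
    · rfl
  have hlt2 := (next (next j)).isLt
  have hc4 : ({j, next j, next (next j), q} : Finset (Fin (2 * n))).card = 2 * 2 := by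
    rw [Finset.card_eq_of_equiv_fin]
    exact (Fintype.equivFinOfCardEq (by
      rw [Fintype.card_coe, Finset.card_insert_of_notMem, Finset.card_insert_of_notMem,
        Finset.card_insert_of_notMem, Finset.card_singleton]
      · simp [hq3.symm]
      · simp [hq2.symm, (next_ne (next j)).symm]
      · simp only [Finset.mem_insert, Finset.mem_singleton, Fin.ext_iff, not_or, v1, v2]
        rw [ne_eq, Fin.ext_iff] at hq1
        omega))
  rw [ne_eq, Fin.ext_iff] at hq1 hq2 hq3
  rw [v1] at hq2
  rw [v2] at hq3
  rcases Nat.lt_or_ge q j with hlt | hge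
  · have e : segment (2 * n) q (q + 1) ∪ segment (2 * n) j (j + 3) =
        {j, next j, next (next j), q} := by
      ext i
      simp only [Finset.mem_union, mem_segment, Finset.mem_insert, Finset.mem_singleton,
        Fin.ext_iff, v1, v2]
      omega
    exact isKDecomposable_of_segments (by omega) (by omega) (by omega) (by omega) (by omega)
      (by omega) (e ▸ hc4) (e ▸ h)
  · have e : segment (2 * n) j (j + 3) ∪ segment (2 * n) q (q + 1) =
        {j, next j, next (next j), q} := by
      ext i
      simp only [Finset.mem_union, mem_segment, Finset.mem_insert, Finset.mem_singleton,
        Fin.ext_iff, v1, v2]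
      omega
    exact isKDecomposable_of_segments (by omega) (by omega) (by omega) (by omega) (by omega)
      (by omega) (e ▸ hc4) (e ▸ h)

theorem isKDecomposable_two_of_pairs {m : Matching n} {k l : Fin (2 * n)}
    (hk : (k : ℕ) ≠ 0) (hk' : (next k : ℕ) ≠ 0) (hl' : (next l : ℕ) ≠ 0)
    (hlt : k < l) (hlk : l ≠ next k) (h : IsClosedOn {k, next k, l, next l} m) :
    m.IsKDecomposable 2 := by
  have hklt := k.isLt
  have hllt := l.isLt
  rw [Fin.lt_def] at hlt
  have v1 : (next k : ℕ) = k + 1 := by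
    rw [next_val] at hk' ⊢
    split_ifs at hk' ⊢
    · omega
    · rfl
  have v2 : (next l : ℕ) = l + 1 := by
    rw [next_val] at hl' ⊢
    split_ifs at hl' ⊢
    · omega
    · rfl
  have hlt2 := (next l).isLt
  rw [ne_eq, Fin.ext_iff, v1] at hlk
  have hc4 : ({k, next k, l, next l} : Finset (Fin (2 * n))).card = 2 * 2 := by
    rw [Finset.card_insert_of_notMem, Finset.card_insert_of_notMem,
      Finset.card_insert_of_notMem, Finset.card_singleton]
    · simp [(next_ne l).symm]
    · simp only [Finset.mem_insert, Finset.mem_singleton, Fin.ext_iff, not_or, v1, v2]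
      omega
    · simp only [Finset.mem_insert, Finset.mem_singleton, Fin.ext_iff, not_or, v1, v2]
      omega
  have e : segment (2 * n) k (k + 2) ∪ segment (2 * n) l (l + 2) = {k, next k, l, next l} := by
    ext i
    simp only [Finset.mem_union, mem_segment, Finset.mem_insert, Finset.mem_singleton,
      Fin.ext_iff, v1, v2]
    omega
  exact isKDecomposable_of_segments (by omega) (by omega) (by omega) (by omega) (by omega)
    (by omega) (e ▸ hc4) (e ▸ h)

/-- The point `z` is close to a pattern of the matching. -/
def IsExceptional (z : Fin (2 * n)) (m : Matching n) : Prop :=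
  ((∃ α ∈ patterns m, z ∈ α.pts) ∨ (m (next z) = next (next z) ∨ m (prev z) = next z)) ∨
    ((m (next (m z)) = next (next (m z)) ∧ next (m z) ≠ z) ∨
      (m (prev (m z)) = next (m z) ∧ prev (m z) ≠ z))

theorem prob_isExceptional_le (hn : 5 ≤ n) (z : Fin (2 * n)) :
    prob (IsExceptional z) ≤ 22 / n := by
  classical
  have h1 : prob (fun m : Matching n => ∃ α ∈ patterns m, z ∈ α.pts) ≤ 16 / n := by
    refine le_trans (mean_mono fun m => ?_) (mean_card_patterns_mem_le hn z)
    by_cases h : ∃ α ∈ patterns m, z ∈ α.pts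
    · rw [ind_of h, Nat.one_le_cast, Nat.succ_le_iff, Finset.card_pos]
      obtain ⟨α, hα, hz⟩ := h
      exact ⟨α, Finset.mem_filter.2 ⟨hα, hz⟩⟩
    · rw [ind_of_not h]
      positivity
  have h2 := prob_apply_eq_le hn (next z) (next (next z))
  have h2' := prob_apply_eq_le hn (prev z) (next z)
  have h3 : prob (fun m : Matching n => m (next (m z)) = next (next (m z)) ∧ next (m z) ≠ z) ≤
      2 / n ^ 1 := by
    refine prob_exists_apply_eq_le (by omega) z
      (fun m q => m (next q) = next (next q) ∧ next q ≠ z) 1 fun q => ?_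
    by_cases hq : next q = z
    · rw [prob_eq_zero fun m hm => hm.2.2 hq]
      positivity
    · exact (prob_mono fun m hm => ⟨hm.1, hm.2.1⟩).trans
        (prob_two_apply_eq_le hn (d := next (next q)) hq (next_ne q))
  have h4 : prob (fun m : Matching n => m (prev (m z)) = next (m z) ∧ prev (m z) ≠ z) ≤
      2 / n ^ 1 := by
    refine prob_exists_apply_eq_le (by omega) z
      (fun m q => m (prev q) = next q ∧ prev q ≠ z) 1 fun q => ?_
    by_cases hq : prev q = z
    · rw [prob_eq_zero fun m hm => hm.2.2 hq]
      positivity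
    · refine (prob_mono fun m hm => ⟨hm.1, hm.2.1⟩).trans
        (prob_two_apply_eq_le hn (d := next q) hq ?_)
      rw [ne_eq, prev_eq_iff]
      exact (next_ne q).symm
  rw [pow_one] at h3 h4
  calc prob (IsExceptional z) ≤ _ := (prob_or_le _ _).trans
        (add_le_add ((prob_or_le _ _).trans (add_le_add le_rfl (prob_or_le _ _)))
          (prob_or_le _ _))
    _ ≤ (16 / n + (1 / n + 1 / n)) + (2 / n + 2 / n) :=
        add_le_add (add_le_add h1 (add_le_add h2 h2')) (add_le_add h3 h4)
    _ = 22 / n := by ring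

/-- A chord {k, k+1} is completed by k-1 and its partner, a chord {k, k+2} by k+1 and its partner; a
pair of chords already has four points. The exceptional event covers exactly the ways in which `z`
can be one of these points. -/
theorem isKDecomposable_two_of_patterns_nonempty (hn : 2 ≤ n) {z : Fin (2 * n)}
    (hz : (z : ℕ) = 0) {m : Matching n} (hm : ¬ IsExceptional z m) (h : (patterns m).Nonempty) :
    m.IsKDecomposable 2 := by
  have hz' : ∀ i : Fin (2 * n), i ≠ z → (i : ℕ) ≠ 0 := fun i hi h =>
    hi (Fin.ext (h.trans hz.symm))
  simp only [IsExceptional, not_or, not_exists, not_and, not_not] at hm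
  obtain ⟨⟨h1, h2, h2'⟩, h3, h4⟩ := hm
  obtain ⟨α, hα⟩ := h
  have hαz := h1 α hα
  obtain ⟨hv, ho⟩ := mem_patterns.1 hα
  obtain ⟨t, k, l⟩ := α
  rcases hv with ⟨ht, hl⟩ | ⟨ht, hl⟩ | ⟨ht, hl⟩ <;> simp only at ht hl <;> subst ht
  · subst hl
    have ho1 : m k = next k := by simpa [Pattern.a, Pattern.b] using ho.1
    have hk : z ≠ k := fun h => hαz (by simp [Pattern.pts, Pattern.a, h])
    have hnk : z ≠ next k := fun h => hαz (by simp [Pattern.pts, Pattern.b, h])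
    obtain ⟨j, rfl⟩ : ∃ j, k = next j := ⟨prev k, (next_prev k).symm⟩
    have hjz : j ≠ z := fun h => h2 (h ▸ ho1)
    -- If `z` were the partner of the added point `j`, a short chord would start right after `m z`,
    -- which is excluded.
    have hqz : m j ≠ z := by
      intro h
      rw [apply_eq_comm] at h
      rw [h] at h3
      exact hk (h3 ho1).symm
    have ho2 := m.apply_eq_comm.1 ho1
    have e1 : m j ≠ next j := fun h => next_next_ne hn j (ho1.symm.trans (m.apply_eq_comm.1 h))
    have e2 : m j ≠ next (next j) := fun h => next_ne j (m.injective (ho1.trans h.symm))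
    refine isKDecomposable_two_of_triple (hz' _ (Ne.symm hk)) (hz' _ (Ne.symm hnk)) (hz' _ hjz)
      (hz' _ hqz) (m.apply_ne j) e1 e2 ?_
    intro i hi
    simp only [Finset.mem_insert, Finset.mem_singleton] at hi ⊢
    rcases hi with rfl | rfl | rfl | rfl <;> simp [ho1, ho2, apply_apply]
  · subst hl
    have ho1 : m k = next (next k) := by simpa [Pattern.a, Pattern.b] using ho.1
    have hk : z ≠ k := fun h => hαz (by simp [Pattern.pts, Pattern.a, h])
    have hnk : z ≠ next (next k) := fun h => hαz (by simp [Pattern.pts, Pattern.b, h])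
    have hjz : next k ≠ z := by
      rintro rfl
      rw [prev_next] at h2'
      exact h2' ho1
    have hqz : m (next k) ≠ z := by
      intro h
      rw [apply_eq_comm] at h
      rw [h, prev_next] at h4
      exact hk (h4 ho1).symm
    have ho2 := m.apply_eq_comm.1 ho1
    have e1 : m (next k) ≠ k := fun h =>
      next_ne (next k) (ho1.symm.trans (m.apply_eq_comm.1 h))
    have e2 : m (next k) ≠ next (next k) := fun h => next_ne k (m.injective (h.trans ho1.symm))
    refine isKDecomposable_two_of_triple (hz' _ hjz) (hz' _ (Ne.symm hnk)) (hz' _ (Ne.symm hk))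
      (hz' _ hqz) e1 (m.apply_ne _) e2 ?_
    intro i hi
    simp only [Finset.mem_insert, Finset.mem_singleton] at hi ⊢
    rcases hi with rfl | rfl | rfl | rfl <;> simp [ho1, ho2, apply_apply]
  · have hcl : IsClosedOn {k, next k, l, next l} m := by
      have h5 := (mem_patterns_two.1 hα).2
      intro i hi
      simp only [Finset.mem_insert, Finset.mem_singleton] at hi ⊢
      split_ifs at h5
      · have h6 := m.apply_eq_comm.1 h5.1
        have h7 := m.apply_eq_comm.1 h5.2
        rcases hi with rfl | rfl | rfl | rfl <;> simp [h5, h6, h7]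
      · have h6 := m.apply_eq_comm.1 h5.1
        have h7 := m.apply_eq_comm.1 h5.2
        rcases hi with rfl | rfl | rfl | rfl <;> simp [h5, h6, h7]
    have hpts : ∀ i ∈ ({k, next k, l, next l} : Finset (Fin (2 * n))),
        i ∈ Pattern.pts ((2, k, l) : Pattern n) := by
      intro i hi
      simp only [Finset.mem_insert, Finset.mem_singleton] at hi
      by_cases hlk : l < k <;>
        simp only [Pattern.pts, Pattern.a, Pattern.b, Pattern.c, Pattern.d, hlk, and_true, if_true,
          not_true, not_false_iff, and_false, if_false, Finset.mem_insert,
          Finset.mem_singleton] <;>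
        clear * - hi <;> tauto
    have hnz : ∀ i ∈ ({k, next k, l, next l} : Finset (Fin (2 * n))), (i : ℕ) ≠ 0 :=
      fun i hi => hz' i fun h => hαz (h ▸ hpts i hi)
    rcases lt_or_gt_of_ne hl.1 with hlt | hlt
    · refine isKDecomposable_two_of_pairs (hnz _ (by simp)) (hnz _ (by simp)) (hnz _ (by simp))
        hlt hl.2.2 ?_
      have e : ({l, next l, k, next k} : Finset (Fin (2 * n))) = {k, next k, l, next l} := by
        ext i
        simp only [Finset.mem_insert, Finset.mem_singleton]
        clear * -
        tauto
      rw [e]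
      exact hcl
    · exact isKDecomposable_two_of_pairs (hnz _ (by simp)) (hnz _ (by simp)) (hnz _ (by simp))
        hlt hl.2.1 hcl

end Matching

/-! ### Limits of the decomposability probabilities -/

namespace Matching

theorem patternCount_eq_zero_iff {n : ℕ} (m : Matching n) :
    patternCount m = 0 ↔ ¬ (patterns m).Nonempty := by
  rw [Finset.not_nonempty_iff_eq_empty, ← Finset.card_eq_zero, ← sum_patternCount,
    Finset.sum_eq_zero_iff, funext_iff]
  simp

/-- Outside an event of probability at most 22/n, being 2-decomposable is the same as containing a
pattern, so the limit is the Poisson mass at 0. -/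
theorem tendsto_prob_not_isKDecomposable_two :
    Tendsto (fun n : ℕ => prob fun m : Matching n => ¬ m.IsKDecomposable 2) atTop
      (𝓝 (Real.exp (-3))) := by
  have h1 := tendsto_prob_patternCount 0
  simp only [Pi.zero_apply, Nat.factorial_zero, Nat.cast_one, inv_one, Finset.prod_const_one,
    mul_one] at h1
  have h2 : Tendsto (fun n : ℕ => prob (fun m : Matching n => ¬ m.IsKDecomposable 2) -
      prob (fun m : Matching n => patternCount m = 0)) atTop (𝓝 0) := by
    refine squeeze_zero_norm' ?_ (tendsto_const_div_atTop_nhds_zero_nat (22 : ℝ))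
    filter_upwards [eventually_ge_atTop 5] with n hn
    refine (abs_prob_sub_le _ _ (IsExceptional ⟨0, by omega⟩) fun m hm => ?_).trans
      (prob_isExceptional_le hn _)
    rw [patternCount_eq_zero_iff, not_iff_not]
    exact ⟨patterns_nonempty_of_isKDecomposable_two (by omega),
      isKDecomposable_two_of_patterns_nonempty (by omega) rfl hm⟩
  have h3 := h2.add h1
  rw [zero_add] at h3
  refine h3.congr fun n => ?_
  ring

theorem prob_large_decomposable_isBigO :
    (fun n : ℕ => prob fun m : Matching n =>
        ∃ k : ℕ, 2 < k ∧ k + 2 ≤ n ∧ m.IsKDecomposable k)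
      =O[atTop] (fun n : ℕ => 1 / (n : ℝ)) := by
  refine IsBigO.of_bound 8100 ?_
  filter_upwards [eventually_ge_atTop 10] with n hn
  rw [Real.norm_of_nonneg (prob_nonneg _), Real.norm_of_nonneg (by positivity), mul_one_div]
  exact prob_large_decomposable_le hn

theorem prob_not_isKDecomposable_two_le {n : ℕ} :
    prob (fun m : Matching n => ¬ m.IsKDecomposable 2) ≤
      prob (fun m : Matching n => m.IsIndecomposable) +
        prob (fun m : Matching n => ∃ k : ℕ, 2 < k ∧ k + 2 ≤ n ∧ m.IsKDecomposable k) := by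
  refine (prob_mono fun m hm => ?_).trans (prob_or_le _ _)
  by_cases h : m.IsDecomposable
  · obtain ⟨k, hk, hkn, h⟩ := h
    refine Or.inr ⟨k, lt_of_le_of_ne hk ?_, hkn, h⟩
    rintro rfl
    exact hm h
  · exact Or.inl h

/-- The difference of the probabilities of "not 2-decomposable" and of "k-decomposable for some
larger admissible k" is a lower bound, and it tends to e^{-3}. -/
theorem eventually_lt_prob_isIndecomposable :
    ∀ᶠ n : ℕ in atTop, Real.exp (-4) < prob fun m : Matching n => m.IsIndecomposable := by
  have h1 : Tendsto (fun n : ℕ => prob fun m : Matching n =>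
      ∃ k : ℕ, 2 < k ∧ k + 2 ≤ n ∧ m.IsKDecomposable k) atTop (𝓝 0) :=
    prob_large_decomposable_isBigO.trans_tendsto tendsto_one_div_atTop_nhds_zero_nat
  have h2 := tendsto_prob_not_isKDecomposable_two.sub h1
  rw [sub_zero] at h2
  have h3 : Real.exp (-4) < Real.exp (-3) := Real.exp_lt_exp.2 (by norm_num)
  filter_upwards [h2.eventually (lt_mem_nhds h3)] with n hn
  linarith [prob_not_isKDecomposable_two_le (n := n)]

end Matching

theorem mainTheorem9 :
    (∀ᶠ n : ℕ in atTop,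
      Real.exp (-4) < (uniformMatching n).real {m | m.IsIndecomposable}) ∧
    Tendsto (fun n : ℕ => (uniformMatching n).real {m | ¬ m.IsKDecomposable 2})
      atTop (𝓝 (Real.exp (-3))) ∧
    TendstoInDistribution
      (fun (n : ℕ) (m : Matching n) => (m.countX, m.countY, m.countZ)) atTop id
      uniformMatching
      ((poissonMeasure 1).prod ((poissonMeasure 1).prod (poissonMeasure 1))) ∧
    (fun n : ℕ => (uniformMatching n).real
        {m | ∃ k : ℕ, 2 < k ∧ k + 2 ≤ n ∧ m.IsKDecomposable k})
      =O[atTop] (fun n : ℕ => 1 / (n : ℝ)) := by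
  simp only [Matching.real_uniformMatching]
  exact ⟨Matching.eventually_lt_prob_isIndecomposable,
    Matching.tendsto_prob_not_isKDecomposable_two, Matching.tendstoInDistribution_count,
    Matching.prob_large_decomposable_isBigO⟩
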